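/- Let $\mathcal Y$ be a finite set, $d\in\mathbb N$, and let $\|\cdot\|$ be any norm on $\mathbb R^d$ whose square is smooth: $\|\cdot\|^2$ is differentiable and for some constant $K$, $\|w'\|^2\le\|w\|^2+\langle\nabla\|w\|^2,w'-w\rangle+\frac K2\|w'-w\|^2$ for all $w,w'$. Let $\{P_w\}_{w\in\mathbb R^d}$ be stochastic matrices on $\mathcal Y$ such that every matrix in the closure of $\{P_w\}$ is irreducible and aperiodic; let $d_w$ be the stationary distribution of $P_w$. Let $H:\mathbb R^d\times\mathcal Y\to\mathbb R^d$ satisfy $\|H(w_1,y)-H(w_2,y)\|\le C_H\|w_1-w_2\|$ for all $w_1,w_2,y$ and some constant $C_H$, and put $h(w)=\sum_y d_w(y)H(w,y)$. Let $\alpha_t=\alpha/(t+t_0)^{\epsilon_\alpha}$ with constants $\alpha>0$, $t_0>0$, $\epsilon_\alpha\in(1/2,1]$. Fix $w_{\rm ref}\in\mathbb R^d$ and let $L(w)=\frac12\|w-w_{\rm ref}\|^2$. Consider the stochastic approximation $w_{t+1}=w_t+\alpha_tH(w_t,Y_{t+1})$, $t\ge0$, where, for every $t$ and $y$, the conditional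 probability of $Y_{t+1}=y$ given the history up to time $t$ (which determines $w_0,Y_0,\dots,Y_t$) is $P_{w_t}(Y_t,y)$. Assume at least one of the following, for some constant $C$ and a fixed norm on matrices: (A3) $\mathbb E\|w_0\|^2<\infty$ (in particular, $w_0$ may be deterministic), and for all $w_1,w_2$, $\|P_{w_1}-P_{w_2}\|\le\frac{C}{1+\|w_1\|+\|w_2\|}\|w_1-w_2\|$ and $\|h(w_1)-h(w_2)\|\le C\|w_1-w_2\|$; (A3′) there is a constant $U$ such that $\sup_t\|w_t\|<U$ almost surely, $\|P_{w_1}-P_{w_2}\|\le C\|w_1-w_2\|$ for all $w_1,w_2$, and $\|h(w_1)-h(w_2)\|\le C\|w_1-w_2\|$ whenever $\max\{\|w_1\|,\|w_2\|\}\le U$. Then there exist $\bar t\in\mathbb N$ and a function $f:\mathbb N\to\mathbb R$ with $$f(t)=O\!\left(\frac{\ln^2(t+t_0+1)}{(t+t_0)^{2\epsilon_\alpha}}\right)\quad(t\to\infty)$$ such that for all $t\ge\bar t$ the expectations below are finite and $$\mathbb E[L(w_{t+1})]\le(1+f(t))\,\mathbb E[L(w_t)]+\alpha_t\,\mathbb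 E[\langle\nabla L(w_t),h(w_t)\rangle]+f(t).$$ Moreover $\bar t$ and $f$ depend on the process $\{(w_t,Y_t)\}$ (its probability space and initial distribution included) only through $U$ in case (A3′), and not at all in case (A3). -/

import Mathlib

open MeasureTheory Filter Asymptotics
open scoped Matrix RealInnerProductSpace

namespace MarkovSA

/-- A function `N` on `ℝ^d` that is a norm: a seminorm that vanishes only at `0`. -/
def IsNorm {d : ℕ} (N : Seminorm ℝ (EuclideanSpace ℝ (Fin d))) : Prop :=
  ∀ x, N x = 0 → x = 0

/-- `f` is differentiable and `K`-smooth with respect to `N`. -/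
def IsSmoothWith {d : ℕ} (N : Seminorm ℝ (EuclideanSpace ℝ (Fin d))) (K : ℝ)
    (f : EuclideanSpace ℝ (Fin d) → ℝ) : Prop :=
  Differentiable ℝ f ∧
    ∀ w w', f w' ≤ f w + ⟪gradient f w, w' - w⟫ + K / 2 * N (w' - w) ^ 2

/-- Every state of the chain with transition matrix `P` has period one. -/
def IsAperiodic {Y : Type*} [Fintype Y] [DecidableEq Y] (P : Matrix Y Y ℝ) : Prop :=
  ∀ y, Nat.setGcd {n : ℕ | 0 < n ∧ 0 < (P ^ n) y y} = 1

/-- `p` is a stationary probability distribution of `P`. -/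
def IsStationary {Y : Type*} [Fintype Y] (P : Matrix Y Y ℝ) (p : Y → ℝ) : Prop :=
  (∀ y, 0 ≤ p y) ∧ ∑ y, p y = 1 ∧ p ᵥ* P = p

/-- The stationary distribution of `P`; it is unique if `P` is an irreducible stochastic matrix. -/
noncomputable def stationaryDist {Y : Type*} [Fintype Y] (P : Matrix Y Y ℝ) : Y → ℝ :=
  Classical.epsilon (IsStationary P)

/-- The expected update `h(w) = ∑_y d_w(y) H(w, y)`, `d_w` being the stationary distribution
of `P w`. -/
noncomputable def expectedUpdate {d : ℕ} {Y : Type*} [Fintype Y]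
    (P : EuclideanSpace ℝ (Fin d) → Matrix Y Y ℝ)
    (H : EuclideanSpace ℝ (Fin d) → Y → EuclideanSpace ℝ (Fin d))
    (w : EuclideanSpace ℝ (Fin d)) : EuclideanSpace ℝ (Fin d) :=
  ∑ y, stationaryDist (P w) y • H w y

/-- The `P w` are transition matrices, and every matrix in the closure of the family is
irreducible and aperiodic. -/
def UniformlyErgodic {d : ℕ} {Y : Type*} [Fintype Y] [DecidableEq Y]
    (P : EuclideanSpace ℝ (Fin d) → Matrix Y Y ℝ) : Prop :=
  (∀ w, P w ∈ Matrix.rowStochastic ℝ Y) ∧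
    ∀ Q ∈ closure (Set.range P), Q.IsIrreducible ∧ IsAperiodic Q

/-- `H` is Lipschitz in the weight, uniformly in the noise. -/
def UpdateLipschitz {d : ℕ} {Y : Type*} (N : Seminorm ℝ (EuclideanSpace ℝ (Fin d)))
    (H : EuclideanSpace ℝ (Fin d) → Y → EuclideanSpace ℝ (Fin d)) : Prop :=
  ∃ C : ℝ, ∀ w₁ w₂ y, N (H w₁ y - H w₂ y) ≤ C * N (w₁ - w₂)

/-- `P` is Lipschitz with the damping factor `1 / (1 + ‖w₁‖ + ‖w₂‖)` and the expected update is
globally Lipschitz. Matrices are compared in the norm induced by the `ℓ^∞` norm (the largest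
absolute row sum); all matrix norms are equivalent, which only changes the constant. -/
def DampedLipschitz {d : ℕ} {Y : Type*} [Fintype Y]
    (N : Seminorm ℝ (EuclideanSpace ℝ (Fin d)))
    (P : EuclideanSpace ℝ (Fin d) → Matrix Y Y ℝ)
    (H : EuclideanSpace ℝ (Fin d) → Y → EuclideanSpace ℝ (Fin d)) : Prop :=
  ∃ C : ℝ,
    (∀ w₁ w₂ y, ∑ y', |P w₁ y y' - P w₂ y y'| ≤ C / (1 + N w₁ + N w₂) * N (w₁ - w₂)) ∧
    (∀ w₁ w₂, N (expectedUpdate P H w₁ - expectedUpdate P H w₂) ≤ C * N (w₁ - w₂))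

/-- `P` is Lipschitz, and the expected update is Lipschitz on the ball of radius `U`.
Matrices are again compared in the norm induced by the `ℓ^∞` norm. -/
def LocallyLipschitzUpTo {d : ℕ} {Y : Type*} [Fintype Y]
    (N : Seminorm ℝ (EuclideanSpace ℝ (Fin d))) (U : ℝ)
    (P : EuclideanSpace ℝ (Fin d) → Matrix Y Y ℝ)
    (H : EuclideanSpace ℝ (Fin d) → Y → EuclideanSpace ℝ (Fin d)) : Prop :=
  ∃ C : ℝ,
    (∀ w₁ w₂ y, ∑ y', |P w₁ y y' - P w₂ y y'| ≤ C * N (w₁ - w₂)) ∧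
    (∀ w₁ w₂, max (N w₁) (N w₂) ≤ U →
      N (expectedUpdate P H w₁ - expectedUpdate P H w₂) ≤ C * N (w₁ - w₂))

/-- The learning rate `α_t = a / (t + t₀) ^ ε`. -/
noncomputable def learningRate (a t₀ ε : ℝ) (t : ℕ) : ℝ := a / ((t : ℝ) + t₀) ^ ε

/-- `w` are the iterates of `w_{t+1} = w_t + α_t H(w_t, Y_{t+1})`, and given the history up to
time `t` (any filtration to which the process is adapted, such as the one generated by
`w_0, Y_0, …, Y_t`) the noise `Y_{t+1}` is drawn from the row `P_{w_t}(Y_t, ·)`. -/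
structure IsSAProcess {d : ℕ} {Y Ω : Type*} {mΩ : MeasurableSpace Ω} (μ : Measure Ω)
    (ℱ : Filtration ℕ mΩ) (α : ℕ → ℝ)
    (P : EuclideanSpace ℝ (Fin d) → Matrix Y Y ℝ)
    (H : EuclideanSpace ℝ (Fin d) → Y → EuclideanSpace ℝ (Fin d))
    (w : ℕ → Ω → EuclideanSpace ℝ (Fin d)) (η : ℕ → Ω → Y) : Prop where
  measurable_init : Measurable[ℱ 0] (w 0)
  measurable_noise : ∀ t, Measurable[ℱ t, ⊤] (η t)
  update : ∀ t ω, w (t + 1) ω = w t ω + α t • H (w t ω) (η (t + 1) ω)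
  transition : ∀ t y,
    μ[({ω | η (t + 1) ω = y}).indicator (fun _ => (1 : ℝ)) | ℱ t]
      =ᵐ[μ] fun ω => P (w t ω) (η t ω) y

/-- `L(w) = ½ ‖w - w_ref‖²`. -/
noncomputable def lyapunov {d : ℕ} (N : Seminorm ℝ (EuclideanSpace ℝ (Fin d)))
    (wref w : EuclideanSpace ℝ (Fin d)) : ℝ := 1 / 2 * N (w - wref) ^ 2

/-- For all `t ≥ T`, the expectations below exist and
`E L(w_{t+1}) ≤ (1 + f(t)) E L(w_t) + α_t E⟨∇L(w_t), h(w_t)⟩ + f(t)`. -/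
def LyapunovRecursion {d : ℕ} {Ω : Type*} {mΩ : MeasurableSpace Ω} (μ : Measure Ω)
    (L : EuclideanSpace ℝ (Fin d) → ℝ)
    (h : EuclideanSpace ℝ (Fin d) → EuclideanSpace ℝ (Fin d)) (α : ℕ → ℝ)
    (w : ℕ → Ω → EuclideanSpace ℝ (Fin d)) (T : ℕ) (f : ℕ → ℝ) : Prop :=
  ∀ t ≥ T,
    Integrable (fun ω => L (w t ω)) μ ∧
    Integrable (fun ω => L (w (t + 1) ω)) μ ∧
    Integrable (fun ω => ⟪gradient L (w t ω), h (w t ω)⟫) μ ∧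
    ∫ ω, L (w (t + 1) ω) ∂μ ≤
      (1 + f t) * ∫ ω, L (w t ω) ∂μ
        + α t * ∫ ω, ⟪gradient L (w t ω), h (w t ω)⟫ ∂μ + f t

end MarkovSA

/-! Write `L` for the Lyapunov function, `h` for the expected update, and let `g w y = ⟪∇L w, H w y
- h w⟫`. Smoothness of `L` bounds `L(w_{t+1})` by `L(w_t) + α_t ⟪∇L(w_t), h(w_t)⟫ + α_t g(w_t,
Y_{t+1})` plus a term of order `α_t² (1 + ‖w_t‖)²`. Everything rests on showing that the bias `E
g(w_t, Y_{t+1})` is of order `ln² t / t^ε` times `E (1 + ‖w_t‖)²`. The remaining factor `α_t` then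
produces the exponent `2ε`, and `(1 + ‖w‖)² ≤ K (1 + L w)` turns the error into `f(t) E L(w_t) +
f(t)`.

For the bias, look back over a window of `n ~ ln t` steps, starting at time `s`. Replacing `w_t` by
`w_s` in `g` costs order `n α`. Replacing the transition matrices along the window by `P w_s` costs
order `n α` at each of `n` steps, hence `n² α`, the source of the squared logarithm. The frozen
chain then mixes geometrically, and `g w` has mean zero under the stationary distribution, so what
remains is at most `t^(-ε)` up to a constant (`IsSAProcess.abs_integral_field_le`, `exists_window`).
Since `g` already grows quadratically, an undamped change of matrices would cost a cubic moment; the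
damping cancels exactly one factor of growth.

The mixing rate is uniform in `w` by compactness of the closure of the family
(`UniformlyErgodic.exists_mixing`). The case of bounded iterates reduces to the damped one, because
on a ball the damping factor is bounded below. -/

namespace MarkovSA

/-! ### Uniform geometric ergodicity of the family of chains -/

section Mixing

/-- An average of the values of `v` is within the oscillation of `v` of any of its values. -/
lemma abs_sub_sum_mul_le {Y : Type*} [Fintype Y] {p v : Y → ℝ} (hp : ∀ y, 0 ≤ p y) (hp1 : ∑ y, p y = 1) {B : ℝ}
    (hv : ∀ y y', v y - v y' ≤ B) (y : Y) : |v y - ∑ z, p z * v z| ≤ B := by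
  have h : v y - ∑ z, p z * v z = ∑ z, p z * (v y - v z) := by
    simp only [mul_sub, Finset.sum_sub_distrib]
    rw [← Finset.sum_mul, hp1, one_mul]
  rw [h]
  calc |∑ z, p z * (v y - v z)| ≤ ∑ z, |p z * (v y - v z)| := Finset.abs_sum_le_sum_abs _ _
    _ ≤ ∑ z, p z * B := Finset.sum_le_sum fun z _ => by
        rw [abs_mul, abs_of_nonneg (hp z)]
        refine mul_le_mul_of_nonneg_left (abs_le.2 ⟨?_, hv y z⟩) (hp z)
        linarith [hv z y]
    _ = B := by rw [← Finset.sum_mul, hp1, one_mul]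

variable {Y : Type*} [Fintype Y] [DecidableEq Y]

/-- The return times to `j` generate an additive monoid with gcd one, which contains every large
integer; a path from `i` to `j` is prefixed to such a loop. -/
lemma exists_pow_apply_pos_of_ge {Q : Matrix Y Y ℝ} (hQ : Q ∈ Matrix.rowStochastic ℝ Y)
    (hirr : Q.IsIrreducible) (hap : IsAperiodic Q) (i j : Y) :
    ∃ n, ∀ k ≥ n, 0 < (Q ^ k) i j := by
  have hpos_mul : ∀ (a b : ℕ) (x y z : Y), 0 < (Q ^ a) x y → 0 < (Q ^ b) y z →
      0 < (Q ^ (a + b)) x z := by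
    intro a b x y z hx hz
    rw [pow_add, Matrix.mul_apply]
    exact Finset.sum_pos' (fun u _ => mul_nonneg ((pow_mem hQ a).1 _ _) ((pow_mem hQ b).1 _ _))
      ⟨y, Finset.mem_univ _, mul_pos hx hz⟩
  obtain ⟨n, hn⟩ := Nat.exists_mem_closure_of_ge {n : ℕ | 0 < n ∧ 0 < (Q ^ n) j j}
  obtain ⟨l, -, hl⟩ := (Matrix.isIrreducible_iff_exists_pow_pos hQ.1).1 hirr i j
  refine ⟨l + n, fun k hk => ?_⟩
  have hmem := hn (k - l) (by omega) (by rw [hap j]; exact one_dvd _)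
  have hjj : 0 < (Q ^ (k - l)) j j := by
    refine AddSubmonoid.closure_induction (motive := fun m _ => 0 < (Q ^ m) j j) (fun m hm => hm.2)
      (by simp) (fun a b _ _ ha hb => hpos_mul a b j j j ha hb) hmem
  have := hpos_mul l (k - l) i j j hl hjj
  rwa [Nat.add_sub_cancel' (by omega)] at this

lemma exists_pow_pos_of_ge {Q : Matrix Y Y ℝ} (hQ : Q ∈ Matrix.rowStochastic ℝ Y)
    (hirr : Q.IsIrreducible) (hap : IsAperiodic Q) :
    ∃ n, ∀ k ≥ n, ∀ i j, 0 < (Q ^ k) i j := by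
  choose n hn using exists_pow_apply_pos_of_ge hQ hirr hap
  refine ⟨∑ i, ∑ j, n i j, fun k hk i j => hn i j k (le_trans ?_ hk)⟩
  calc n i j ≤ ∑ j, n i j := Finset.single_le_sum (f := fun j => n i j) (by simp) (Finset.mem_univ j)
    _ ≤ _ := Finset.single_le_sum (f := fun i => ∑ j, n i j) (by simp) (Finset.mem_univ i)

/-- Each row of a stochastic matrix has a positive entry, so multiplying on the left preserves
positivity. This lets one exponent serve a whole finite subcover. -/
lemma pow_pos_of_ge {Q : Matrix Y Y ℝ} (hQ : Q ∈ Matrix.rowStochastic ℝ Y) {n : ℕ}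
    (hn : ∀ i j, 0 < (Q ^ n) i j) {k : ℕ} (hk : n ≤ k) (i j : Y) : 0 < (Q ^ k) i j := by
  have hR := pow_mem hQ (k - n)
  obtain ⟨l, hl⟩ : ∃ l, 0 < (Q ^ (k - n)) i l := by
    by_contra! h
    have h1 := Matrix.sum_row_of_mem_rowStochastic hR i
    have h2 : ∑ l, (Q ^ (k - n)) i l ≤ 0 := Finset.sum_nonpos fun l _ => h l
    linarith
  have : Q ^ k = Q ^ (k - n) * Q ^ n := by rw [← pow_add]; congr 1; omega
  rw [this, Matrix.mul_apply]
  exact Finset.sum_pos' (fun u _ => mul_nonneg (hR.1 _ _) (hn _ _).le)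
      ⟨l, Finset.mem_univ _, mul_pos hl (hn _ _)⟩

lemma isClosed_rowStochastic : IsClosed (Matrix.rowStochastic ℝ Y : Set (Matrix Y Y ℝ)) := by
  have : (Matrix.rowStochastic ℝ Y : Set (Matrix Y Y ℝ))
      = (⋂ i, ⋂ j, {M | 0 ≤ M i j}) ∩ ⋂ i, {M | ∑ j, M i j = 1} := by
    ext M
    simp [Matrix.mem_rowStochastic_iff_sum]
  rw [this]
  refine (isClosed_iInter fun i => isClosed_iInter fun j => ?_).inter (isClosed_iInter fun i => ?_)
  · exact isClosed_le continuous_const (continuous_id.matrix_elem i j)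
  · exact isClosed_eq (continuous_finsetSum _ fun j _ => continuous_id.matrix_elem i j)
      continuous_const

lemma isCompact_rowStochastic : IsCompact (Matrix.rowStochastic ℝ Y : Set (Matrix Y Y ℝ)) := by
  have hc : IsCompact (Set.pi Set.univ fun _ : Y => Set.pi Set.univ fun _ : Y =>
      Set.Icc (0 : ℝ) 1) :=
    isCompact_univ_pi fun _ => isCompact_univ_pi fun _ => isCompact_Icc
  refine IsCompact.of_isClosed_subset hc isClosed_rowStochastic fun M hM => ?_
  exact fun i _ j _ => ⟨hM.1 i j, Matrix.le_one_of_mem_rowStochastic hM⟩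

/-- The sets of matrices with a positive given power are open and cover the compact closure, so one
power is positive on all of it; its entries are continuous and attain positive minima. -/
lemma UniformlyErgodic.exists_minorization {d : ℕ} {P : EuclideanSpace ℝ (Fin d) → Matrix Y Y ℝ}
    (hP : UniformlyErgodic P) :
    ∃ m > 0, ∃ δ : ℝ, 0 < δ ∧ δ < 1 ∧ ∀ w i j, δ ≤ (P w ^ m) i j := by
  set K := closure (Set.range P)
  have hKs : K ⊆ (Matrix.rowStochastic ℝ Y : Set (Matrix Y Y ℝ)) :=
    closure_minimal (by rintro _ ⟨w, rfl⟩; exact hP.1 w) isClosed_rowStochastic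
  have hK : IsCompact K := isCompact_rowStochastic.of_isClosed_subset isClosed_closure hKs
  obtain ⟨m, hm⟩ : ∃ m : ℕ, K ⊆ {Q | ∀ i j, 0 < (Q ^ (m + 1)) i j} ∩
      (Matrix.rowStochastic ℝ Y : Set (Matrix Y Y ℝ)) ∪
      (Matrix.rowStochastic ℝ Y : Set (Matrix Y Y ℝ))ᶜ := by
    have hopen : ∀ m : ℕ, IsOpen {Q : Matrix Y Y ℝ | ∀ i j, 0 < (Q ^ (m + 1)) i j} := by
      intro m
      have : {Q : Matrix Y Y ℝ | ∀ i j, 0 < (Q ^ (m + 1)) i j}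
          = ⋂ i, ⋂ j, {Q : Matrix Y Y ℝ | 0 < (Q ^ (m + 1)) i j} := by ext; simp
      rw [this]
      exact isOpen_iInter_of_finite fun i => isOpen_iInter_of_finite fun j =>
        isOpen_lt continuous_const ((continuous_pow (m + 1)).matrix_elem i j)
    obtain ⟨t, ht⟩ := hK.elim_finite_subcover _ hopen fun Q hQ => by
      obtain ⟨n, hn⟩ := exists_pow_pos_of_ge (hKs hQ) (hP.2 Q hQ).1 (hP.2 Q hQ).2
      exact Set.mem_iUnion.2 ⟨n, hn (n + 1) (by omega)⟩
    refine ⟨t.sup id, fun Q hQ => Or.inl ⟨?_, hKs hQ⟩⟩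
    obtain ⟨n, hn, hQn⟩ := Set.mem_iUnion₂.1 (ht hQ)
    have : n ≤ t.sup id := Finset.le_sup (f := id) hn
    exact fun i j => pow_pos_of_ge (hKs hQ) hQn (by omega) i j
  have hpos : ∀ Q ∈ K, ∀ i j, 0 < (Q ^ (m + 1)) i j := fun Q hQ => by
    rcases hm hQ with h | h
    · exact h.1
    · exact absurd (hKs hQ) h
  have hδ : ∀ i j, ∃ δ : ℝ, 0 < δ ∧ ∀ Q ∈ K, δ ≤ (Q ^ (m + 1)) i j := by
    intro i j
    have hne : K.Nonempty := ⟨P 0, subset_closure ⟨0, rfl⟩⟩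
    obtain ⟨Q, hQ, hmin⟩ := hK.exists_isMinOn hne
      (((continuous_pow (m + 1)).matrix_elem i j).continuousOn)
    exact ⟨_, hpos Q hQ i j, fun R hR => hmin hR⟩
  choose δ hδ0 hδ1 using hδ
  rcases isEmpty_or_nonempty Y with hY | hY
  · exact ⟨m + 1, by omega, 1 / 2, by norm_num, by norm_num, fun w i => isEmptyElim i⟩
  obtain ⟨p, hp⟩ := Finite.exists_min fun p : Y × Y => δ p.1 p.2
  -- With a single state the minimum is `1`; the cap `1 / 2` keeps `δ < 1`.
  refine ⟨m + 1, by omega, min (δ p.1 p.2) (1 / 2), lt_min (hδ0 _ _) (by norm_num),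
    (min_le_right _ _).trans_lt (by norm_num), fun w i j => ?_⟩
  exact (min_le_left _ _).trans ((hp (i, j)).trans (hδ1 i j _ (subset_closure ⟨w, rfl⟩)))

/-- Doeblin's contraction: every row puts mass at least `δ` on a minimizer `z` of `v`, and this mass
contributes nothing to the excess over `v z`. -/
lemma mulVec_sub_le_of_minorization {Q : Matrix Y Y ℝ} (hQ : Q ∈ Matrix.rowStochastic ℝ Y)
    {δ B : ℝ} (hδ : ∀ i j, δ ≤ Q i j) (hB : 0 ≤ B) {v : Y → ℝ} (hv : ∀ y y', v y - v y' ≤ B)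
    (y y' : Y) : (Q *ᵥ v) y - (Q *ᵥ v) y' ≤ (1 - δ) * B := by
  have : Nonempty Y := ⟨y⟩
  obtain ⟨z, hz⟩ := Finite.exists_min v
  have h1 : v z ≤ (Q *ᵥ v) y' := by
    calc v z = ∑ x, Q y' x * v z := by
          rw [← Finset.sum_mul, Matrix.sum_row_of_mem_rowStochastic hQ, one_mul]
      _ ≤ _ := Finset.sum_le_sum fun x _ => mul_le_mul_of_nonneg_left (hz x) (hQ.1 _ _)
  have h2 : (Q *ᵥ v) y - v z ≤ (1 - δ) * B := by
    calc (Q *ᵥ v) y - v z = ∑ x, Q y x * (v x - v z) := by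
          simp only [mul_sub, Finset.sum_sub_distrib]
          rw [← Finset.sum_mul, Matrix.sum_row_of_mem_rowStochastic hQ, one_mul]; rfl
      _ ≤ ∑ x, (Q y x * B - if x = z then Q y x * B else 0) := by
          refine Finset.sum_le_sum fun x _ => ?_
          split_ifs with h
          · simp [h]
          · simpa using mul_le_mul_of_nonneg_left (hv x z) (hQ.1 y x)
      _ = (1 - Q y z) * B := by
          rw [Finset.sum_sub_distrib, ← Finset.sum_mul, Matrix.sum_row_of_mem_rowStochastic hQ]
          simp; ring
      _ ≤ _ := mul_le_mul_of_nonneg_right (by linarith [hδ y z]) hB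
  linarith

lemma pow_mulVec_sub_le {Q : Matrix Y Y ℝ} (hQ : Q ∈ Matrix.rowStochastic ℝ Y)
    {δ B : ℝ} {m : ℕ} (hδ1 : δ ≤ 1) (hδ : ∀ i j, δ ≤ (Q ^ m) i j) (hB : 0 ≤ B) {v : Y → ℝ}
    (hv : ∀ y y', v y - v y' ≤ B) (j : ℕ) (y y' : Y) :
    ((Q ^ (m * j)) *ᵥ v) y - ((Q ^ (m * j)) *ᵥ v) y' ≤ (1 - δ) ^ j * B := by
  induction j generalizing y y' with
  | zero => simpa using hv y y'
  | succ j ih =>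
    have : (Q ^ (m * (j + 1))) *ᵥ v = (Q ^ m) *ᵥ ((Q ^ (m * j)) *ᵥ v) := by
      rw [Matrix.mulVec_mulVec, ← pow_add]; congr 2; ring
    rw [this, pow_succ', mul_assoc]
    exact mulVec_sub_le_of_minorization (pow_mem hQ m) hδ
      (mul_nonneg (pow_nonneg (by linarith) _) hB) ih y y'

/-- For `n ≥ m * j`, the entry `(Q ^ n) y₀ z` is an average of column `z` of `Q ^ (m * j)`, whose
oscillation is at most `(1 - δ) ^ j`. Hence row `y₀` of the powers is Cauchy, and its limit is
stationary. -/
lemma exists_isStationary [Nonempty Y] {Q : Matrix Y Y ℝ} (hQ : Q ∈ Matrix.rowStochastic ℝ Y)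
    {δ : ℝ} {m : ℕ} (hδ0 : 0 < δ) (hδ1 : δ < 1) (hδ : ∀ i j, δ ≤ (Q ^ m) i j) :
    ∃ p, IsStationary Q p := by
  obtain ⟨y₀⟩ := ‹Nonempty Y›
  have hlim : ∀ z, ∃ l, Tendsto (fun n => (Q ^ n) y₀ z) atTop (nhds l) := by
    intro z
    refine cauchySeq_tendsto_of_complete (Metric.cauchySeq_iff'.2 fun e he => ?_)
    obtain ⟨j, hj⟩ := exists_pow_lt_of_lt_one he (by linarith : 1 - δ < 1)
    refine ⟨m * j, fun n hn => ?_⟩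
    have hosc := pow_mulVec_sub_le hQ hδ1.le hδ zero_le_one (v := Pi.single z 1)
      (fun y y' => by
        by_cases h : y = z <;> by_cases h' : y' = z <;> simp [h, h']) j
    have hR := pow_mem hQ (n - m * j)
    have := abs_sub_sum_mul_le (hR.1 y₀) (Matrix.sum_row_of_mem_rowStochastic hR y₀) hosc y₀
    have hcol : ∀ k y, ((Q ^ k) *ᵥ Pi.single z 1) y = (Q ^ k) y z := by simp
    have hn' : Q ^ n = Q ^ (n - m * j) * Q ^ (m * j) := by rw [← pow_add]; congr 1; omega
    simp only [hcol] at this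
    rw [← Matrix.mul_apply, ← hn'] at this
    rw [dist_comm, Real.dist_eq]
    linarith
  choose p hp using hlim
  refine ⟨p, fun y => ge_of_tendsto' (hp y) fun n => (pow_mem hQ n).1 _ _, ?_, ?_⟩
  · refine tendsto_nhds_unique (tendsto_finsetSum _ fun y _ => hp y) ?_
    simp_rw [Matrix.sum_row_of_mem_rowStochastic (pow_mem hQ _)]
    exact tendsto_const_nhds
  · ext z
    refine tendsto_nhds_unique (f := fun n => (Q ^ (n + 1)) y₀ z) ?_
      ((tendsto_add_atTop_iff_nat 1).2 (hp z))
    simp_rw [pow_succ, Matrix.mul_apply]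
    exact tendsto_finsetSum _ fun y _ => (hp y).mul_const _

lemma IsStationary.dotProduct_pow_mulVec {Q : Matrix Y Y ℝ} {p : Y → ℝ} (hp : IsStationary Q p)
    (n : ℕ) (v : Y → ℝ) : p ⬝ᵥ ((Q ^ n) *ᵥ v) = p ⬝ᵥ v := by
  induction n with
  | zero => simp
  | succ n ih => rw [pow_succ', ← Matrix.mulVec_mulVec, Matrix.dotProduct_mulVec, hp.2.2, ih]

/-- Uniform geometric ergodicity along multiples of a fixed number of steps. -/
theorem UniformlyErgodic.exists_mixing {d : ℕ} [Nonempty Y]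
    {P : EuclideanSpace ℝ (Fin d) → Matrix Y Y ℝ} (hP : UniformlyErgodic P) :
    (∀ w, IsStationary (P w) (stationaryDist (P w))) ∧
    ∃ m > 0, ∃ ρ : ℝ, 0 < ρ ∧ ρ < 1 ∧ ∀ w j (v : Y → ℝ) (B : ℝ), (∀ y, |v y| ≤ B) → ∀ y,
      |((P w ^ (m * j)) *ᵥ v) y - ∑ z, stationaryDist (P w) z * v z| ≤ ρ ^ j * (2 * B) := by
  obtain ⟨m, hm, δ, hδ0, hδ1, hδ⟩ := hP.exists_minorization
  -- Existence is enough here: the bound below holds for any stationary distribution.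
  have hst : ∀ w, IsStationary (P w) (stationaryDist (P w)) := fun w =>
    Classical.epsilon_spec (exists_isStationary (hP.1 w) hδ0 hδ1 (hδ w))
  refine ⟨hst, m, hm, 1 - δ, by linarith, by linarith, fun w j v B hv y => ?_⟩
  have hB : 0 ≤ B := (abs_nonneg _).trans (hv y)
  have := abs_sub_sum_mul_le (hst w).1 (hst w).2.1 (pow_mulVec_sub_le (hP.1 w) hδ1.le (hδ w)
    (by linarith : 0 ≤ 2 * B) (v := v)
    (fun y y' => by linarith [(abs_le.1 (hv y)).2, (abs_le.1 (hv y')).1]) j) y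
  have h2 := (hst w).dotProduct_pow_mulVec (m * j) v
  simp only [dotProduct] at h2
  rwa [h2] at this

end Mixing

/-! ### Regularity of the Lyapunov function and comparison of norms -/

section Smoothness

lemma add_inner_gradient_le {E : Type*} [NormedAddCommGroup E] [InnerProductSpace ℝ E]
    [CompleteSpace E] {f : E → ℝ} (hf : ConvexOn ℝ Set.univ f) {x : E}
    (hd : DifferentiableAt ℝ f x) (y : E) : f x + ⟪gradient f x, y - x⟫ ≤ f y := by
  have hline : HasDerivAt (fun s : ℝ => f (x + s • (y - x))) ⟪gradient f x, y - x⟫ 0 := by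
    have h1 : HasDerivAt (fun s : ℝ => x + s • (y - x)) (y - x) 0 := by
      simpa using ((hasDerivAt_id (0 : ℝ)).smul_const (y - x)).const_add x
    have h2 : HasFDerivAt f (InnerProductSpace.toDual ℝ E (gradient f x)) (x + (0 : ℝ) • (y - x)) := by
      simpa using hd.hasGradientAt.hasFDerivAt
    have h3 := h2.comp_hasDerivAt (0 : ℝ) h1
    rwa [InnerProductSpace.toDual_apply_apply] at h3
  have hconv : ConvexOn ℝ Set.univ (fun s : ℝ => f (x + s • (y - x))) := by
    have := hf.comp_affineMap (AffineMap.lineMap x y : ℝ →ᵃ[ℝ] E)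
    refine (this.congr fun s _ => ?_)
    simp [AffineMap.lineMap_apply, add_comm]
  have := hconv.le_slope_of_hasDerivAt (Set.mem_univ 0) (Set.mem_univ 1) one_pos hline
  simp only [slope_def_field, one_smul, zero_smul, add_zero, add_sub_cancel, sub_zero, div_one] at this
  linarith

/-- A convex function with a quadratic upper bound has a Lipschitz gradient. -/
lemma norm_gradient_sub_le {E : Type*} [NormedAddCommGroup E] [InnerProductSpace ℝ E]
    [CompleteSpace E] {f : E → ℝ} (hf : ConvexOn ℝ Set.univ f) (hd : Differentiable ℝ f) {K : ℝ}
    (hK : 0 < K) (hub : ∀ w w', f w' ≤ f w + ⟪gradient f w, w' - w⟫ + K / 2 * ‖w' - w‖ ^ 2)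
    (x y : E) : ‖gradient f y - gradient f x‖ ≤ K * ‖y - x‖ := by
  set v := gradient f y - gradient f x with hv
  -- `z` minimizes the quadratic upper model at `y` minus the tangent at `x`. Comparing the two at
  -- `z`, and then bounding `f y` by the upper model at `x`, leaves `‖v‖²` against `‖y - x‖²`.
  set z := y - K⁻¹ • v with hz
  have h1 := add_inner_gradient_le hf (hd x) z
  have h2 := hub y z
  have h3 := hub x y
  have e1 : ⟪gradient f x, z - x⟫ = ⟪gradient f x, y - x⟫ - K⁻¹ * ⟪gradient f x, v⟫ := by
    rw [hz, sub_right_comm, inner_sub_right, inner_smul_right]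
  have hzy : z - y = -(K⁻¹ • v) := by rw [hz]; abel
  have e2 : ⟪gradient f y, z - y⟫ = - (K⁻¹ * ⟪gradient f y, v⟫) := by
    rw [hzy, inner_neg_right, inner_smul_right]
  have e3 : ‖z - y‖ ^ 2 = K⁻¹ ^ 2 * ‖v‖ ^ 2 := by
    rw [hzy, norm_neg, norm_smul, mul_pow, Real.norm_eq_abs, sq_abs]
  have e4 : ⟪gradient f y, v⟫ - ⟪gradient f x, v⟫ = ‖v‖ ^ 2 := by
    rw [← inner_sub_left, real_inner_self_eq_norm_sq]
  rw [e1] at h1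
  rw [e2, e3] at h2
  have hmain : K⁻¹ * ‖v‖ ^ 2 - K / 2 * (K⁻¹ ^ 2 * ‖v‖ ^ 2) ≤ K / 2 * ‖y - x‖ ^ 2 := by
    have : K⁻¹ * ‖v‖ ^ 2 = K⁻¹ * ⟪gradient f y, v⟫ - K⁻¹ * ⟪gradient f x, v⟫ := by
      rw [← e4]; ring
    linarith
  have hsimp : K⁻¹ * ‖v‖ ^ 2 - K / 2 * (K⁻¹ ^ 2 * ‖v‖ ^ 2) = K⁻¹ / 2 * ‖v‖ ^ 2 := by
    field_simp; ring
  rw [hsimp] at hmain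
  have : ‖v‖ ^ 2 ≤ (K * ‖y - x‖) ^ 2 := by
    calc ‖v‖ ^ 2 = 2 * K * (K⁻¹ / 2 * ‖v‖ ^ 2) := by field_simp
      _ ≤ 2 * K * (K / 2 * ‖y - x‖ ^ 2) := by gcongr
      _ = _ := by ring
  exact le_of_sq_le_sq this (by positivity)

variable {d : ℕ} (N : Seminorm ℝ (EuclideanSpace ℝ (Fin d)))

lemma continuous_seminorm : Continuous N := by
  rw [← continuousOn_univ]
  exact N.convexOn.continuousOn isOpen_univ

lemma exists_seminorm_le : ∃ C > 0, ∀ x, N x ≤ C * ‖x‖ :=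
  N.bound_of_continuous_normedSpace (continuous_seminorm N)

lemma exists_norm_le_seminorm (hN : IsNorm N) : ∃ C > 0, ∀ x, ‖x‖ ≤ C * N x := by
  -- The unit sphere is empty when `d = 0`.
  rcases (Metric.sphere (0 : EuclideanSpace ℝ (Fin d)) 1).eq_empty_or_nonempty with h | h
  · refine ⟨1, one_pos, fun x => ?_⟩
    have hx : x = 0 := by
      by_contra hx
      have : (‖x‖⁻¹ • x) ∈ Metric.sphere (0 : EuclideanSpace ℝ (Fin d)) 1 := by
        simp [norm_smul, hx]
      simp [h] at this
    simp [hx]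
  · obtain ⟨z, hz, hmin⟩ := (isCompact_sphere (0 : EuclideanSpace ℝ (Fin d)) 1).exists_isMinOn h
      (continuous_seminorm N).continuousOn
    have hz1 : ‖z‖ = 1 := by simpa using hz
    have hpos : 0 < N z := lt_of_le_of_ne (apply_nonneg N z) fun h0 => by
      simp [hN z h0.symm] at hz1
    refine ⟨(N z)⁻¹, inv_pos.2 hpos, fun x => ?_⟩
    by_cases hx : x = 0
    · simp [hx]
    have hxn : 0 < ‖x‖ := norm_pos_iff.2 hx
    have hmem : (‖x‖⁻¹ • x) ∈ Metric.sphere (0 : EuclideanSpace ℝ (Fin d)) 1 := by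
      simp [norm_smul, hx]
    have := hmin hmem
    simp only [Set.mem_ofPred_eq, map_smul_eq_mul, norm_inv, norm_norm] at this
    rw [← div_eq_inv_mul, le_div_iff₀ hpos]
    calc ‖x‖ * N z ≤ ‖x‖ * (‖x‖⁻¹ * N x) := by gcongr
      _ = N x := by field_simp

/-- The regularity of the Lyapunov function that the drift analysis uses, expressed in the
Euclidean norm. -/
structure IsLyapunov (L : EuclideanSpace ℝ (Fin d) → ℝ) (K : ℝ) : Prop where
  pos : 0 < K
  differentiable : Differentiable ℝ L
  nonneg : ∀ w, 0 ≤ L w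
  norm_gradient_sub_le : ∀ w w', ‖gradient L w - gradient L w'‖ ≤ K * ‖w - w'‖
  le_add : ∀ w w', L w' ≤ L w + ⟪gradient L w, w' - w⟫ + K * ‖w' - w‖ ^ 2
  le_growth : ∀ w, L w ≤ K * (1 + ‖w‖) ^ 2
  growth_le : ∀ w, (1 + ‖w‖) ^ 2 ≤ K * (1 + L w)

lemma hasGradientAt_lyapunov (hd : Differentiable ℝ (fun w => N w ^ 2))
    (wref w : EuclideanSpace ℝ (Fin d)) :
    HasGradientAt (lyapunov N wref) ((1 / 2 : ℝ) • gradient (fun w => N w ^ 2) (w - wref)) w := by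
  rw [hasGradientAt_iff_hasFDerivAt]
  have h1 := (hd (w - wref)).hasGradientAt.hasFDerivAt
  have h2 : HasFDerivAt (fun w => w - wref)
      (ContinuousLinearMap.id ℝ (EuclideanSpace ℝ (Fin d))) w := (hasFDerivAt_id w).sub_const wref
  have h3 := (h1.comp w h2).const_mul (1 / 2)
  refine (show HasFDerivAt (lyapunov N wref) _ w from h3).congr_fderiv ?_
  ext v
  simp

lemma exists_isLyapunov (hN : IsNorm N)
    (hsmooth : ∃ K : ℝ, IsSmoothWith N K (fun w => N w ^ 2)) (wref : EuclideanSpace ℝ (Fin d)) :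
    ∃ K, IsLyapunov (lyapunov N wref) K := by
  obtain ⟨K₀, hd, hub⟩ := hsmooth
  obtain ⟨A, hA, hNA⟩ := exists_seminorm_le N
  obtain ⟨B, hB, hNB⟩ := exists_norm_le_seminorm N hN
  -- `K₀` may be zero or negative, while the gradient bound needs a positive constant.
  set K₁ := (|K₀| + 1) * A ^ 2 with hK₁
  have hK₁pos : 0 < K₁ := by positivity
  have hub' : ∀ w w', N w' ^ 2 ≤ N w ^ 2 + ⟪gradient (fun w => N w ^ 2) w, w' - w⟫
      + K₁ / 2 * ‖w' - w‖ ^ 2 := by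
    intro w w'
    refine (hub w w').trans (add_le_add_right ?_ _)
    calc K₀ / 2 * N (w' - w) ^ 2 ≤ (|K₀| + 1) / 2 * N (w' - w) ^ 2 := by
          gcongr; linarith [le_abs_self K₀]
      _ ≤ (|K₀| + 1) / 2 * (A * ‖w' - w‖) ^ 2 := by
          gcongr; exact hNA _
      _ = _ := by rw [hK₁]; ring
  have hconv : ConvexOn ℝ Set.univ (fun w => N w ^ 2) :=
    N.convexOn.pow (fun w _ => apply_nonneg N w) 2
  have hgl := norm_gradient_sub_le hconv hd hK₁pos hub'
  have hgrad : ∀ w, gradient (lyapunov N wref) w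
      = (1 / 2 : ℝ) • gradient (fun w => N w ^ 2) (w - wref) := fun w =>
    (hasGradientAt_lyapunov N hd wref w).gradient
  set R := 1 + ‖wref‖ with hR
  have hR1 : 1 ≤ R := by simp [hR]
  -- One summand for the gradient and second-order bounds, one for the upper growth bound, one for
  -- the lower growth bound.
  set K := K₁ + A ^ 2 * R ^ 2 + (2 * R ^ 2 + 4 * B ^ 2) with hK
  have hp1 : 0 ≤ A ^ 2 * R ^ 2 := by positivity
  have hp2 : 0 ≤ 2 * R ^ 2 + 4 * B ^ 2 := by positivity
  refine ⟨K, by positivity, fun w => (hasGradientAt_lyapunov N hd wref w).differentiableAt,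
    fun w => by unfold lyapunov; positivity, fun w w' => ?_, fun w w' => ?_, fun w => ?_,
    fun w => ?_⟩
  · rw [hgrad, hgrad, ← smul_sub, norm_smul]
    have := hgl (w' - wref) (w - wref)
    rw [sub_sub_sub_cancel_right] at this
    have h2 : 0 ≤ ‖w - w'‖ := norm_nonneg _
    calc ‖(1 / 2 : ℝ)‖ * _ ≤ 1 / 2 * (K₁ * ‖w - w'‖) := by
          rw [Real.norm_of_nonneg (by norm_num)]; gcongr
      _ ≤ K₁ * ‖w - w'‖ := by nlinarith [mul_nonneg hK₁pos.le h2]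
      _ ≤ K * ‖w - w'‖ := by gcongr; linarith
  · rw [hgrad, real_inner_smul_left]
    have := hub' (w - wref) (w' - wref)
    rw [sub_sub_sub_cancel_right] at this
    unfold lyapunov
    have h3 : K₁ / 4 * ‖w' - w‖ ^ 2 ≤ K * ‖w' - w‖ ^ 2 := by
      gcongr; linarith
    linarith
  · unfold lyapunov
    have h1 : ‖w - wref‖ ≤ R * (1 + ‖w‖) := by
      have := norm_sub_le w wref
      nlinarith [norm_nonneg w, norm_nonneg wref]
    calc 1 / 2 * N (w - wref) ^ 2 ≤ 1 * (A * (R * (1 + ‖w‖))) ^ 2 := by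
          gcongr
          · norm_num
          · exact (hNA _).trans (by gcongr)
      _ = (A ^ 2 * R ^ 2) * (1 + ‖w‖) ^ 2 := by ring
      _ ≤ _ := by gcongr; linarith
  · have h1 : 1 + ‖w‖ ≤ R + B * N (w - wref) := by
      have h2 : ‖w‖ ≤ ‖w - wref‖ + ‖wref‖ := norm_le_norm_sub_add w wref
      have := hNB (w - wref)
      linarith
    have hL : lyapunov N wref w = 1 / 2 * N (w - wref) ^ 2 := rfl
    have hL0 : 0 ≤ lyapunov N wref w := by rw [hL]; positivity
    calc (1 + ‖w‖) ^ 2 ≤ (R + B * N (w - wref)) ^ 2 := by gcongr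
      _ ≤ 2 * R ^ 2 + 4 * B ^ 2 * lyapunov N wref w := by
          rw [hL]; nlinarith [sq_nonneg (R - B * N (w - wref))]
      _ ≤ (2 * R ^ 2 + 4 * B ^ 2) * (1 + lyapunov N wref w) := by
          nlinarith [mul_nonneg (sq_nonneg R) hL0, sq_nonneg B]
      _ ≤ _ := by gcongr; linarith

end Smoothness

/-! ### Moments of the iterates and the bias of the noise over a window -/

section Iterates

lemma measurable_comp_finite {Ω Y β : Type*} [Finite Y] {m : MeasurableSpace Ω}
    [MeasurableSpace β] {φ : Ω → Y → β} (hφ : ∀ y, Measurable fun ω => φ ω y) {η : Ω → Y}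
    (hη : Measurable[m, ⊤] η) : Measurable fun ω => φ ω (η ω) := by
  intro s hs
  have : (fun ω => φ ω (η ω)) ⁻¹' s = ⋃ y, η ⁻¹' {y} ∩ (fun ω => φ ω y) ⁻¹' s := by
    ext ω; simp
  rw [this]
  have := Set.to_countable (Set.univ : Set Y)
  exact MeasurableSet.iUnion fun y => (hη trivial).inter (hφ y hs)

lemma abs_integral_le_of_abs_le {Ω : Type*} {m : MeasurableSpace Ω} {μ : Measure Ω} {f g : Ω → ℝ}
    (hg : Integrable g μ) (h : ∀ᵐ ω ∂μ, |f ω| ≤ g ω) : |∫ ω, f ω ∂μ| ≤ ∫ ω, g ω ∂μ :=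
  norm_integral_le_of_norm_le (f := f) hg h

variable {d : ℕ} {Y : Type*} {Ω : Type*} {mΩ : MeasurableSpace Ω}
  {μ : Measure Ω} {ℱ : Filtration ℕ mΩ} {α : ℕ → ℝ}
  {P : EuclideanSpace ℝ (Fin d) → Matrix Y Y ℝ}
  {H : EuclideanSpace ℝ (Fin d) → Y → EuclideanSpace ℝ (Fin d)}
  {w : ℕ → Ω → EuclideanSpace ℝ (Fin d)} {η : ℕ → Ω → Y}

lemma IsSAProcess.measurable_iterate [Finite Y] (h : IsSAProcess μ ℱ α P H w η)
    (hH : ∀ y, Measurable fun w => H w y) (t : ℕ) : Measurable[ℱ t] (w t) := by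
  induction t with
  | zero => exact h.measurable_init
  | succ t ih =>
    have h1 : Measurable[ℱ (t + 1)] (w t) := ih.mono (ℱ.mono t.le_succ) le_rfl
    have h2 : Measurable[ℱ (t + 1)] fun ω => H (w t ω) (η (t + 1) ω) :=
      measurable_comp_finite (fun y => (hH y).comp h1) (h.measurable_noise (t + 1))
    have h3 : w (t + 1) = fun ω => w t ω + α t • H (w t ω) (η (t + 1) ω) :=
      funext (h.update t)
    rw [h3]
    exact h1.add (h2.const_smul (α t))

lemma IsSAProcess.measurable_iterate_ambient [Finite Y] (h : IsSAProcess μ ℱ α P H w η)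
    (hH : ∀ y, Measurable fun w => H w y) (t : ℕ) : Measurable (w t) :=
  (h.measurable_iterate hH t).mono (ℱ.le t) le_rfl

lemma IsSAProcess.measurable_noise_ambient (h : IsSAProcess μ ℱ α P H w η) (t : ℕ) :
    Measurable[mΩ, ⊤] (η t) :=
  (h.measurable_noise t).mono (ℱ.le t) le_rfl

lemma IsSAProcess.integrable_growth [Finite Y] (h : IsSAProcess μ ℱ α P H w η)
    (hH : ∀ y, Measurable fun w => H w y) {C : ℝ} (hC : 0 ≤ C)
    (hg : ∀ w y, ‖H w y‖ ≤ C * (1 + ‖w‖)) (h0 : Integrable (fun ω => (1 + ‖w 0 ω‖) ^ 2) μ)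
    (t : ℕ) : Integrable (fun ω => (1 + ‖w t ω‖) ^ 2) μ := by
  induction t with
  | zero => exact h0
  | succ t ih =>
    refine (ih.const_mul ((1 + |α t| * C) ^ 2)).mono' ?_ (.of_forall fun ω => ?_)
    · exact (((h.measurable_iterate_ambient hH (t + 1)).norm.const_add 1).pow_const
        2).aestronglyMeasurable
    · rw [Real.norm_of_nonneg (by positivity), ← mul_pow]
      gcongr
      rw [h.update t ω]
      have h1 := norm_add_le (w t ω) (α t • H (w t ω) (η (t + 1) ω))
      rw [norm_smul, Real.norm_eq_abs] at h1
      have h2 := mul_le_mul_of_nonneg_left (hg (w t ω) (η (t + 1) ω)) (abs_nonneg (α t))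
      linarith

/-- Averaging over the next state of the noise. -/
lemma IsSAProcess.integral_comp_noise_succ [Fintype Y] [IsFiniteMeasure μ]
    (h : IsSAProcess μ ℱ α P H w η) {t : ℕ} {φ : Ω → Y → ℝ}
    (hφ : ∀ y, StronglyMeasurable[ℱ t] fun ω => φ ω y) {ψ : Ω → ℝ} (hψ : Integrable ψ μ)
    (hφψ : ∀ ω y, |φ ω y| ≤ ψ ω) :
    ∫ ω, φ ω (η (t + 1) ω) ∂μ = ∫ ω, ∑ y, P (w t ω) (η t ω) y * φ ω y ∂μ := by
  classical
  set ind : Y → Ω → ℝ := fun y => ({ω | η (t + 1) ω = y}).indicator (fun _ => (1 : ℝ)) with hind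
  have hset : ∀ y, MeasurableSet {ω | η (t + 1) ω = y} := fun y => by
    have hη := h.measurable_noise_ambient (t + 1)
    exact @hη {y} trivial
  have hφint : ∀ y, Integrable (fun ω => φ ω y) μ := fun y =>
    hψ.mono' ((hφ y).mono (ℱ.le t)).aestronglyMeasurable (.of_forall fun ω => hφψ ω y)
  have hindint : ∀ y, Integrable (ind y) μ := fun y =>
    (integrable_const (1 : ℝ)).indicator (hset y)
  have hmul : ∀ y, (fun ω => φ ω y) * ind y
      = ({ω | η (t + 1) ω = y}).indicator fun ω => φ ω y := by
    intro y
    ext ω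
    by_cases hy : η (t + 1) ω = y <;> simp [hind, hy]
  have hmulint : ∀ y, Integrable ((fun ω => φ ω y) * ind y) μ := fun y => by
    rw [hmul]; exact (hφint y).indicator (hset y)
  -- `φ · y` is known at time `t`, so it leaves the conditional expectation and only the transition
  -- probability remains.
  have hce : ∀ y, μ[(fun ω => φ ω y) * ind y | ℱ t]
      =ᵐ[μ] fun ω => P (w t ω) (η t ω) y * φ ω y := by
    intro y
    filter_upwards [condExp_mul_of_stronglyMeasurable_left (hφ y) (hmulint y) (hindint y),
      h.transition t y] with ω h1 h2
    rw [h1, Pi.mul_apply, h2, mul_comm]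
  have hsum : ∀ ω, φ ω (η (t + 1) ω) = ∑ y, ((fun ω => φ ω y) * ind y) ω := by
    intro ω
    simp [hind, Set.indicator_apply]
  simp_rw [hsum]
  rw [integral_finsetSum _ fun y _ => hmulint y,
    integral_finsetSum _ fun y _ => integrable_condExp.congr (hce y)]
  refine Finset.sum_congr rfl fun y _ => ?_
  rw [← integral_congr_ae (hce y), integral_condExp (ℱ.le t)]

/-- A bootstrap: as long as the displacement is at most `1 + ‖w s‖`, the growth factor at most
doubles, so each increment is at most `2 C β (1 + ‖w s‖)`; the smallness condition keeps the
displacement in this range. -/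
lemma IsSAProcess.norm_iterate_sub_le (h : IsSAProcess μ ℱ α P H w η) {C : ℝ} (hC : 0 ≤ C)
    (hg : ∀ w y, ‖H w y‖ ≤ C * (1 + ‖w‖)) {s n : ℕ} {β : ℝ}
    (hα0 : ∀ t, 0 ≤ α t) (hαβ : ∀ i < n, α (s + i) ≤ β) (hβ : 2 * C * (n * β) ≤ 1) (ω : Ω)
    (k : ℕ) (hk : k ≤ n) : ‖w (s + k) ω - w s ω‖ ≤ 2 * C * (k * β) * (1 + ‖w s ω‖) := by
  induction k with
  | zero => simp
  | succ k ih =>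
    have ih := ih (by omega)
    have hβ0 : 0 ≤ β := (hα0 s).trans (by simpa using hαβ 0 (by omega))
    have hle : 2 * C * (k * β) ≤ 1 := by
      refine le_trans ?_ hβ
      have : (k : ℝ) ≤ n := by exact_mod_cast (by omega : k ≤ n)
      gcongr
    have hp : 0 ≤ 1 + ‖w s ω‖ := by positivity
    have h1 : ‖w (s + k) ω - w s ω‖ ≤ 1 + ‖w s ω‖ := ih.trans (by nlinarith)
    have h2 : 1 + ‖w (s + k) ω‖ ≤ 2 * (1 + ‖w s ω‖) := by
      have := norm_le_norm_sub_add (w (s + k) ω) (w s ω)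
      linarith
    have h3 : ‖α (s + k) • H (w (s + k) ω) (η (s + k + 1) ω)‖ ≤ β * (C * (2 * (1 + ‖w s ω‖))) := by
      rw [norm_smul, Real.norm_of_nonneg (hα0 _)]
      refine mul_le_mul (hαβ k (by omega)) ((hg _ _).trans ?_) (norm_nonneg _) hβ0
      gcongr
    have h4 : w (s + (k + 1)) ω - w s ω
        = (w (s + k) ω - w s ω) + α (s + k) • H (w (s + k) ω) (η (s + k + 1) ω) := by
      rw [← add_assoc, h.update]; abel
    rw [h4]
    refine (norm_add_le _ _).trans ((add_le_add ih h3).trans (le_of_eq ?_))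
    push_cast
    ring

/-- A test function of iterate and noise, and the regularity of it and of the transition matrices
on a set `S` of weights. -/
structure IsTestField [Fintype Y] [DecidableEq Y] (P : EuclideanSpace ℝ (Fin d) → Matrix Y Y ℝ)
    (g : EuclideanSpace ℝ (Fin d) → Y → ℝ) (S : Set (EuclideanSpace ℝ (Fin d))) (D G : ℝ) :
    Prop where
  nonneg_damping : 0 ≤ D
  nonneg_growth : 0 ≤ G
  measurable_transition : ∀ y y', Measurable fun w => P w y y'
  stochastic : ∀ w, P w ∈ Matrix.rowStochastic ℝ Y
  damped : ∀ w₁ ∈ S, ∀ w₂ ∈ S, ∀ y,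
    ∑ y', |P w₁ y y' - P w₂ y y'| ≤ D / (1 + ‖w₁‖ + ‖w₂‖) * ‖w₁ - w₂‖
  measurable_field : ∀ y, Measurable fun w => g w y
  abs_le : ∀ w y, |g w y| ≤ G * (1 + ‖w‖) ^ 2
  lipschitz : ∀ w₁ ∈ S, ∀ w₂ ∈ S, ∀ y,
    |g w₁ y - g w₂ y| ≤ G * (1 + ‖w₁‖ + ‖w₂‖) * ‖w₁ - w₂‖

variable [Fintype Y] [DecidableEq Y] {g : EuclideanSpace ℝ (Fin d) → Y → ℝ}
  {S : Set (EuclideanSpace ℝ (Fin d))} {D G : ℝ}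

lemma IsTestField.measurable_pow (hg : IsTestField P g S D G) (j : ℕ) (y : Y) :
    Measurable fun w => ((P w ^ j) *ᵥ g w) y := by
  induction j generalizing y with
  | zero => simpa using hg.measurable_field y
  | succ j ih =>
    simp_rw [pow_succ', ← Matrix.mulVec_mulVec]
    simp only [Matrix.mulVec, dotProduct] at ih ⊢
    exact Finset.measurable_sum _ fun z _ => (hg.measurable_transition y z).mul (ih z)

lemma IsTestField.abs_pow_le (hg : IsTestField P g S D G) (j : ℕ) (v : EuclideanSpace ℝ (Fin d))
    (y : Y) : |((P v ^ j) *ᵥ g v) y| ≤ G * (1 + ‖v‖) ^ 2 := by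
  have hR := pow_mem (hg.stochastic v) j
  simp only [Matrix.mulVec, dotProduct]
  calc |∑ z, (P v ^ j) y z * g v z| ≤ ∑ z, |(P v ^ j) y z * g v z| := Finset.abs_sum_le_sum_abs _ _
    _ ≤ ∑ z, (P v ^ j) y z * (G * (1 + ‖v‖) ^ 2) := Finset.sum_le_sum fun z _ => by
        rw [abs_mul, abs_of_nonneg (hR.1 y z)]
        exact mul_le_mul_of_nonneg_left (hg.abs_le v z) (hR.1 y z)
    _ = _ := by rw [← Finset.sum_mul, Matrix.sum_row_of_mem_rowStochastic hR, one_mul]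

lemma IsSAProcess.integrable_pow (h : IsSAProcess μ ℱ α P H w η)
    (hH : ∀ y, Measurable fun w => H w y) (hg : IsTestField P g S D G) {s : ℕ}
    (hint : Integrable (fun ω => (1 + ‖w s ω‖) ^ 2) μ) (j i : ℕ) :
    Integrable (fun ω => ((P (w s ω) ^ j) *ᵥ g (w s ω)) (η i ω)) μ := by
  refine (hint.const_mul G).mono' ?_ (.of_forall fun ω => hg.abs_pow_le j _ _)
  exact (measurable_comp_finite
    (fun y => (hg.measurable_pow j y).comp (h.measurable_iterate_ambient hH s))
    (h.measurable_noise_ambient i)).aestronglyMeasurable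

/-- Freezing the transition matrix at time `s` for one step of the noise. -/
lemma IsSAProcess.abs_integral_pow_succ_sub_le [IsFiniteMeasure μ]
    (h : IsSAProcess μ ℱ α P H w η)
    (hH : ∀ y, Measurable fun w => H w y) (hg : IsTestField P g S D G)
    (hS : ∀ᵐ ω ∂μ, ∀ t, w t ω ∈ S) {s k : ℕ} (hsk : s ≤ k)
    (hint : Integrable (fun ω => (1 + ‖w s ω‖) ^ 2) μ) {q : ℝ}
    (hq : ∀ ω, ‖w k ω - w s ω‖ ≤ q * (1 + ‖w s ω‖)) (j : ℕ) :
    |∫ ω, ((P (w s ω) ^ j) *ᵥ g (w s ω)) (η (k + 1) ω) ∂μ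
      - ∫ ω, ((P (w s ω) ^ (j + 1)) *ᵥ g (w s ω)) (η k ω) ∂μ|
      ≤ D * q * G * ∫ ω, (1 + ‖w s ω‖) ^ 2 ∂μ := by
  set u : ℕ → EuclideanSpace ℝ (Fin d) → Y → ℝ := fun j v => (P v ^ j) *ᵥ g v with hu
  have hmeas : ∀ y, StronglyMeasurable[ℱ k] fun ω => u j (w s ω) y := fun y =>
    ((hg.measurable_pow j y).comp
      ((h.measurable_iterate hH s).mono (ℱ.mono hsk) le_rfl)).stronglyMeasurable
  have hstep := h.integral_comp_noise_succ hmeas (hint.const_mul G)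
    fun ω y => hg.abs_pow_le j (w s ω) y
  have hInt1 : Integrable (fun ω => ∑ y, P (w k ω) (η k ω) y * u j (w s ω) y) μ := by
    refine (hint.const_mul G).mono' ?_ (.of_forall fun ω => ?_)
    · refine (Finset.measurable_sum _ fun y _ => Measurable.mul ?_
        ((hg.measurable_pow j y).comp (h.measurable_iterate_ambient hH s))).aestronglyMeasurable
      exact measurable_comp_finite (φ := fun ω x => P (w k ω) x y) (fun x =>
        (hg.measurable_transition x y).comp (h.measurable_iterate_ambient hH k))
        (h.measurable_noise_ambient k)
    · have hR := hg.stochastic (w k ω)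
      calc |∑ z, P (w k ω) (η k ω) z * u j (w s ω) z|
          ≤ ∑ z, |P (w k ω) (η k ω) z * u j (w s ω) z| := Finset.abs_sum_le_sum_abs _ _
        _ ≤ ∑ z, P (w k ω) (η k ω) z * (G * (1 + ‖w s ω‖) ^ 2) :=
          Finset.sum_le_sum fun z _ => by
            rw [abs_mul, abs_of_nonneg (hR.1 _ z)]
            exact mul_le_mul_of_nonneg_left (hg.abs_pow_le j _ z) (hR.1 _ z)
        _ = _ := by rw [← Finset.sum_mul, Matrix.sum_row_of_mem_rowStochastic hR, one_mul]
  have hInt2 : Integrable (fun ω => u (j + 1) (w s ω) (η k ω)) μ := h.integrable_pow hH hg hint _ _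
  rw [hstep, ← integral_sub hInt1 hInt2, ← integral_const_mul]
  refine abs_integral_le_of_abs_le (hint.const_mul _) ?_
  filter_upwards [hS] with ω hω
  have hsucc : u (j + 1) (w s ω) (η k ω) = ∑ y, P (w s ω) (η k ω) y * u j (w s ω) y := by
    simp only [hu, pow_succ', ← Matrix.mulVec_mulVec]
    rfl
  have hw : 0 ≤ 1 + ‖w s ω‖ := by positivity
  -- The damping absorbs the factor `1 + ‖w s‖` of the displacement, leaving a bound free of growth;
  -- the total error stays quadratic and so is controlled by `L`.
  have hdamp : ∑ y, |P (w k ω) (η k ω) y - P (w s ω) (η k ω) y| ≤ D * q := by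
    refine (hg.damped _ (hω k) _ (hω s) _).trans ?_
    rw [div_mul_eq_mul_div, div_le_iff₀ (by positivity)]
    have hq0 : 0 ≤ q := by
      by_contra! hneg
      have h1 := norm_nonneg (w k ω - w s ω)
      have h2 : 0 < 1 + ‖w s ω‖ := by positivity
      nlinarith [hq ω]
    calc D * ‖w k ω - w s ω‖ ≤ D * (q * (1 + ‖w s ω‖)) :=
          mul_le_mul_of_nonneg_left (hq ω) hg.nonneg_damping
      _ ≤ D * (q * (1 + ‖w k ω‖ + ‖w s ω‖)) := by
          have := hg.nonneg_damping
          gcongr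
          linarith [norm_nonneg (w k ω)]
      _ = _ := by ring
  rw [hsucc, ← Finset.sum_sub_distrib]
  calc |∑ y, (P (w k ω) (η k ω) y * u j (w s ω) y - P (w s ω) (η k ω) y * u j (w s ω) y)|
      ≤ ∑ y, |P (w k ω) (η k ω) y - P (w s ω) (η k ω) y| * (G * (1 + ‖w s ω‖) ^ 2) := by
        refine (Finset.abs_sum_le_sum_abs _ _).trans (Finset.sum_le_sum fun y _ => ?_)
        rw [← sub_mul, abs_mul]
        exact mul_le_mul_of_nonneg_left (hg.abs_pow_le j _ y) (abs_nonneg _)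
    _ = (∑ y, |P (w k ω) (η k ω) y - P (w s ω) (η k ω) y|) * (G * (1 + ‖w s ω‖) ^ 2) := by
        rw [Finset.sum_mul]
    _ ≤ D * q * (G * (1 + ‖w s ω‖) ^ 2) :=
        mul_le_mul_of_nonneg_right hdamp (mul_nonneg hg.nonneg_growth (by positivity))
    _ = _ := by ring

/-- Telescoping: each step trades one step of the true noise for one more power of the frozen
matrix. -/
lemma IsSAProcess.abs_integral_pow_add_sub_le [IsFiniteMeasure μ]
    (h : IsSAProcess μ ℱ α P H w η)
    (hH : ∀ y, Measurable fun w => H w y) (hg : IsTestField P g S D G)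
    (hS : ∀ᵐ ω ∂μ, ∀ t, w t ω ∈ S) {s n : ℕ}
    (hint : Integrable (fun ω => (1 + ‖w s ω‖) ^ 2) μ) {q : ℝ}
    (hq : ∀ k < n, ∀ ω, ‖w (s + k) ω - w s ω‖ ≤ q * (1 + ‖w s ω‖)) (i : ℕ) (hi : i ≤ n) (j : ℕ) :
    |∫ ω, ((P (w s ω) ^ j) *ᵥ g (w s ω)) (η (s + i) ω) ∂μ
      - ∫ ω, ((P (w s ω) ^ (j + i)) *ᵥ g (w s ω)) (η s ω) ∂μ|
      ≤ i * (D * q * G * ∫ ω, (1 + ‖w s ω‖) ^ 2 ∂μ) := by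
  induction i generalizing j with
  | zero => simp
  | succ i ih =>
    have h1 := h.abs_integral_pow_succ_sub_le hH hg hS (Nat.le_add_right s i) hint
      (hq i (by omega)) j
    have h2 := ih (by omega) (j + 1)
    rw [show j + 1 + i = j + (i + 1) by ring] at h2
    rw [← add_assoc]
    refine (abs_sub_le _ _ _).trans ((add_le_add h1 h2).trans (le_of_eq ?_))
    push_cast
    ring

/-- The bias of the noise after a window of `n` steps: an increment term, a term for the change of
the transition matrices along the window, and a mixing term `r`. -/
theorem IsSAProcess.abs_integral_field_le [IsFiniteMeasure μ]
    (h : IsSAProcess μ ℱ α P H w η)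
    (hH : ∀ y, Measurable fun w => H w y) {C : ℝ} (hC : 0 ≤ C)
    (hHg : ∀ w y, ‖H w y‖ ≤ C * (1 + ‖w‖)) (hg : IsTestField P g S D G)
    (hS : ∀ᵐ ω ∂μ, ∀ t, w t ω ∈ S) {s p : ℕ} {β r : ℝ}
    (hint : Integrable (fun ω => (1 + ‖w 0 ω‖) ^ 2) μ)
    (hα0 : ∀ t, 0 ≤ α t) (hαβ : ∀ i < p + 1, α (s + i) ≤ β)
    (hβ : 4 * C * (((p + 1 : ℕ) : ℝ) * β) ≤ 1) (hr0 : 0 ≤ r)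
    (hr : ∀ w y, |((P w ^ (p + 1)) *ᵥ g w) y| ≤ r * (1 + ‖w‖) ^ 2) :
    |∫ ω, g (w (s + p) ω) (η (s + p + 1) ω) ∂μ|
      ≤ (12 * G * C * (((p + 1 : ℕ) : ℝ) * β)
          + 8 * D * C * G * (((p + 1 : ℕ) : ℝ) * (((p + 1 : ℕ) : ℝ) * β)) + 4 * r)
        * ∫ ω, (1 + ‖w (s + p) ω‖) ^ 2 ∂μ := by
  -- The iterate moves `p` steps, from `s` to `s + p`, but the noise moves `p + 1`, from `s` to `s +
  -- p + 1`.
  set n : ℕ := p + 1 with hn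
  have hI := h.integrable_growth hH hC hHg hint
  have hβ0 : 0 ≤ β := (hα0 s).trans (by simpa using hαβ 0 (by omega))
  set A : ℝ := (n : ℝ) * β with hA
  have hA0 : 0 ≤ A := by positivity
  have hCA : 0 ≤ C * A := by positivity
  have hD := hg.nonneg_damping
  have hG := hg.nonneg_growth
  have hq : ∀ k < n, ∀ ω, ‖w (s + k) ω - w s ω‖ ≤ 2 * C * A * (1 + ‖w s ω‖) := by
    intro k hk ω
    refine (h.norm_iterate_sub_le hC hHg hα0 hαβ (by linarith) ω k hk.le).trans ?_
    have : (k : ℝ) ≤ n := by exact_mod_cast hk.le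
    rw [hA]
    gcongr
  -- Errors arise in terms of `w s` but must be stated at the current time. The constant `4` in `hβ`
  -- gives a displacement of at most half of `1 + ‖w s‖`, which allows this reversal.
  have hgrow : ∀ ω, 1 + ‖w s ω‖ ≤ 2 * (1 + ‖w (s + p) ω‖) := by
    intro ω
    have h1 := hq p (by omega) ω
    have h2 := norm_le_norm_sub_add (w s ω) (w (s + p) ω)
    rw [norm_sub_rev] at h2
    have h3 : 2 * C * A * (1 + ‖w s ω‖) ≤ 1 / 2 * (1 + ‖w s ω‖) := by
      gcongr; linarith
    linarith
  have hMs : ∫ ω, (1 + ‖w s ω‖) ^ 2 ∂μ ≤ 4 * ∫ ω, (1 + ‖w (s + p) ω‖) ^ 2 ∂μ := by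
    rw [← integral_const_mul]
    refine integral_mono (hI s) ((hI _).const_mul 4) fun ω => ?_
    calc (1 + ‖w s ω‖) ^ 2 ≤ (2 * (1 + ‖w (s + p) ω‖)) ^ 2 := by gcongr; exact hgrow ω
      _ = _ := by ring
  set M := ∫ ω, (1 + ‖w (s + p) ω‖) ^ 2 ∂μ with hM
  have hIg : ∀ i j, Integrable (fun ω => g (w i ω) (η j ω)) μ := fun i j => by
    simpa using h.integrable_pow hH hg (hI i) 0 j
  have hfreeze : |∫ ω, g (w (s + p) ω) (η (s + p + 1) ω) ∂μ
      - ∫ ω, g (w s ω) (η (s + p + 1) ω) ∂μ| ≤ 12 * G * C * A * M := by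
    rw [← integral_sub (hIg _ _) (hIg _ _), hM, ← integral_const_mul]
    refine abs_integral_le_of_abs_le ((hI _).const_mul _) ?_
    filter_upwards [hS] with ω hω
    refine (hg.lipschitz _ (hω _) _ (hω _) _).trans ?_
    have h1 : ‖w (s + p) ω - w s ω‖ ≤ 2 * C * A * (2 * (1 + ‖w (s + p) ω‖)) :=
      (hq p (by omega) ω).trans (by gcongr; exact hgrow ω)
    have h2 : 1 + ‖w (s + p) ω‖ + ‖w s ω‖ ≤ 3 * (1 + ‖w (s + p) ω‖) := by
      linarith [hgrow ω]
    calc G * (1 + ‖w (s + p) ω‖ + ‖w s ω‖) * ‖w (s + p) ω - w s ω‖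
        ≤ G * (3 * (1 + ‖w (s + p) ω‖)) * (2 * C * A * (2 * (1 + ‖w (s + p) ω‖))) := by gcongr
      _ = _ := by ring
  have hchain := h.abs_integral_pow_add_sub_le hH hg hS (hI s) hq n le_rfl 0
  simp only [pow_zero, Matrix.one_mulVec, zero_add] at hchain
  have hmix : |∫ ω, ((P (w s ω) ^ n) *ᵥ g (w s ω)) (η s ω) ∂μ|
      ≤ r * ∫ ω, (1 + ‖w s ω‖) ^ 2 ∂μ := by
    rw [← integral_const_mul]
    exact abs_integral_le_of_abs_le ((hI _).const_mul _) (.of_forall fun ω => hr _ _)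
  have e1 : n * (D * (2 * C * A) * G * ∫ ω, (1 + ‖w s ω‖) ^ 2 ∂μ)
      ≤ 8 * D * C * G * (n * A) * M := by
    calc n * (D * (2 * C * A) * G * ∫ ω, (1 + ‖w s ω‖) ^ 2 ∂μ)
        ≤ n * (D * (2 * C * A) * G * (4 * M)) := by gcongr
      _ = _ := by ring
  have e2 : r * ∫ ω, (1 + ‖w s ω‖) ^ 2 ∂μ ≤ r * (4 * M) := by gcongr
  rw [show s + n = s + p + 1 by omega] at hchain
  have b1 := abs_le.1 hfreeze
  have b2 := abs_le.1 hchain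
  have b3 := abs_le.1 hmix
  rw [abs_le]
  constructor <;> linarith [b1.1, b1.2, b2.1, b2.2, b3.1, b3.2]

end Iterates

/-! ### Choice of the window length -/

section Schedule

lemma pow_le_one_div_rpow {ρ ε x : ℝ} (hρ0 : 0 < ρ) (hρ1 : ρ < 1) (hε : 0 < ε) (hx0 : 0 < x)
    {j : ℕ} (hj : ε / -Real.log ρ * Real.log (x + 1) ≤ j) : ρ ^ j ≤ 1 / x ^ ε := by
  have hlogρ : 0 < -Real.log ρ := by linarith [Real.log_neg hρ0 hρ1]
  have e1 : ρ ^ j = Real.exp (Real.log ρ * j) := by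
    rw [← Real.rpow_natCast, Real.rpow_def_of_pos hρ0]
  have h2 : -Real.log ρ * (ε / -Real.log ρ * Real.log (x + 1)) = ε * Real.log (x + 1) := by
    rw [← mul_assoc, mul_div_cancel₀ _ hlogρ.ne']
  have h3 : Real.log x ≤ Real.log (x + 1) := Real.log_le_log hx0 (by linarith)
  have h4 := mul_le_mul_of_nonneg_left hj hlogρ.le
  have h5 := mul_le_mul_of_nonneg_left h3 hε.le
  rw [e1, one_div, ← Real.rpow_neg hx0.le, Real.rpow_def_of_pos hx0]
  refine Real.exp_le_exp.2 ?_
  linarith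

set_option maxHeartbeats 400000 in
/-- The windows over which the noise is compared with its stationary distribution: their length is
a multiple of `m` and logarithmic in time. -/
lemma exists_window {a t₀ ε : ℝ} (ha : 0 < a) (ht₀ : 0 < t₀) (hε : 0 < ε) {m : ℕ} (hm : 0 < m)
    {ρ : ℝ} (hρ0 : 0 < ρ) (hρ1 : ρ < 1) {C : ℝ} (hC : 0 ≤ C) :
    ∃ (T : ℕ) (B : ℝ), 0 ≤ B ∧ ∀ t ≥ T, ∃ (s p j : ℕ) (β : ℝ), s + p = t ∧ p + 1 = m * j ∧
      (∀ i < p + 1, learningRate a t₀ ε (s + i) ≤ β) ∧ C * (((p + 1 : ℕ) : ℝ) * β) ≤ 1 ∧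
      ((p + 1 : ℕ) : ℝ) * β ≤ B * (Real.log (t + t₀ + 1) ^ 2 / (t + t₀) ^ ε) ∧
      ((p + 1 : ℕ) : ℝ) * (((p + 1 : ℕ) : ℝ) * β)
        ≤ B * (Real.log (t + t₀ + 1) ^ 2 / (t + t₀) ^ ε) ∧
      ρ ^ j ≤ B * (Real.log (t + t₀ + 1) ^ 2 / (t + t₀) ^ ε) ∧
      learningRate a t₀ ε t ≤ B * (Real.log (t + t₀ + 1) ^ 2 / (t + t₀) ^ ε) := by
  have hlogρ : 0 < -Real.log ρ := by linarith [Real.log_neg hρ0 hρ1]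
  set c := ε / -Real.log ρ with hc
  have hc0 : 0 < c := by positivity
  -- Once `l ≥ 1`, the window length `m * ⌈c * l⌉₊` is at most `κ * l`.
  set κ := (m : ℝ) * (c + 1) with hκ
  have hm' : (0 : ℝ) < m := by exact_mod_cast hm
  have hκ0 : 0 < κ := by positivity
  -- The window will lie where time plus `t₀` is at least `x / 2`, so its learning rates are at most
  -- `a / (x / 2) ^ ε = b / x ^ ε`.
  set b := a * 2 ^ ε with hb
  have hb0 : 0 < b := by positivity
  have htend : Tendsto (fun t : ℕ => (t : ℝ) + t₀ + 1) atTop atTop :=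
    tendsto_atTop_add_const_right _ _ (tendsto_atTop_add_const_right _ _ tendsto_natCast_atTop_atTop)
  -- The first threshold makes the window at most `t / 2` long, the second makes `C` times length
  -- times rate at most `1`.
  have hη1 : 0 < 1 / (4 * κ) := by positivity
  have hη2 : 0 < 1 / (C * κ * b * 2 ^ ε + 1) := by positivity
  have E1 : ∀ᶠ t : ℕ in atTop, 1 ≤ Real.log ((t : ℝ) + t₀ + 1) :=
    (Real.tendsto_log_atTop.comp htend).eventually_ge_atTop 1
  have E2 := htend.eventually ((isLittleO_log_rpow_atTop one_pos).def hη1)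
  have E3 := htend.eventually ((isLittleO_log_rpow_atTop hε).def hη2)
  have E4 : ∀ᶠ t : ℕ in atTop, t₀ + 1 ≤ (t : ℝ) :=
    tendsto_natCast_atTop_atTop.eventually_ge_atTop _
  obtain ⟨T, hT⟩ := eventually_atTop.1 (E1.and (E2.and (E3.and E4)))
  -- The four summands serve, in order, the last four bounds of the statement.
  refine ⟨T, κ * b + κ ^ 2 * b + 1 + a, by positivity, fun t ht => ?_⟩
  obtain ⟨hl1, h2, h3, h4⟩ := hT t ht
  set x : ℝ := (t : ℝ) + t₀ with hx
  have hx1 : 1 ≤ x := by linarith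
  have hx0 : 0 < x := by linarith
  set l := Real.log (x + 1) with hl
  have hl0 : 0 < l := by linarith
  have hxε : 0 < x ^ ε := by positivity
  rw [Real.norm_of_nonneg hl0.le, Real.rpow_one, Real.norm_of_nonneg (by positivity)] at h2
  rw [Real.norm_of_nonneg hl0.le, Real.norm_of_nonneg (by positivity)] at h3
  have h2' : κ * l ≤ t / 2 := by
    have : κ * l ≤ (x + 1) / 4 := by
      calc κ * l ≤ κ * (1 / (4 * κ) * (x + 1)) := by gcongr
        _ = _ := by field_simp
    linarith
  have h3' : C * (κ * l * (b / x ^ ε)) ≤ 1 := by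
    have e1 : (x + 1) ^ ε ≤ 2 ^ ε * x ^ ε := by
      rw [← Real.mul_rpow (by norm_num) hx0.le]
      exact Real.rpow_le_rpow (by linarith) (by linarith) hε.le
    have e2 : C * κ * b * l ≤ x ^ ε := by
      calc C * κ * b * l ≤ C * κ * b * (1 / (C * κ * b * 2 ^ ε + 1) * (2 ^ ε * x ^ ε)) := by
            gcongr
            exact h3.trans (by gcongr)
        _ = (C * κ * b * 2 ^ ε) / (C * κ * b * 2 ^ ε + 1) * x ^ ε := by ring
        _ ≤ 1 * x ^ ε := by
            gcongr
            rw [div_le_one (by positivity)]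
            linarith
        _ = _ := one_mul _
    calc C * (κ * l * (b / x ^ ε)) = C * κ * b * l / x ^ ε := by ring
      _ ≤ 1 := (div_le_one hxε).2 e2
  set j := ⌈c * l⌉₊ with hj
  have hj1 : 1 ≤ j := Nat.one_le_ceil_iff.2 (by positivity)
  have hjl : (j : ℝ) ≤ (c + 1) * l := by
    have := (Nat.ceil_lt_add_one (by positivity : 0 ≤ c * l)).le
    linarith
  have hn1 : 1 ≤ m * j := Nat.mul_pos hm hj1
  have hnl : ((m * j : ℕ) : ℝ) ≤ κ * l := by
    push_cast
    rw [hκ, mul_assoc]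
    gcongr
  have hnt : m * j ≤ t := by
    have : ((m * j : ℕ) : ℝ) ≤ t := by linarith [Nat.cast_nonneg (α := ℝ) t]
    exact_mod_cast this
  have hp : m * j - 1 + 1 = m * j := by omega
  have hbx : 0 ≤ b / x ^ ε := by positivity
  have hR : 1 / x ^ ε ≤ l ^ 2 / x ^ ε := by gcongr; exact one_le_pow₀ hl1
  have hR0 : 0 ≤ l ^ 2 / x ^ ε := by positivity
  refine ⟨t + 1 - m * j, m * j - 1, j, b / x ^ ε, by omega, hp, ?_, ?_, ?_, ?_, ?_, ?_⟩
  · intro i _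
    have hs : x / 2 ≤ ((t + 1 - m * j + i : ℕ) : ℝ) + t₀ := by
      have : ((t + 1 - m * j : ℕ) : ℝ) = t + 1 - (m * j : ℕ) := by
        rw [Nat.cast_sub (by omega)]; push_cast; ring
      rw [Nat.cast_add, this]
      have := Nat.cast_nonneg (α := ℝ) i
      linarith
    have h22 : b / x ^ ε = a / (x / 2) ^ ε := by
      rw [Real.div_rpow hx0.le (by norm_num), hb]; field_simp
    rw [h22, learningRate]
    gcongr
  · rw [hp]
    refine le_trans ?_ h3'
    gcongr
  · rw [hp]
    calc ((m * j : ℕ) : ℝ) * (b / x ^ ε) ≤ κ * l * (b / x ^ ε) := by gcongr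
      _ = κ * b * (l / x ^ ε) := by ring
      _ ≤ κ * b * (l ^ 2 / x ^ ε) := by gcongr; exact le_self_pow₀ hl1 two_ne_zero
      _ ≤ _ := by
        gcongr
        have : 0 ≤ κ ^ 2 * b := by positivity
        linarith
  · rw [hp]
    calc ((m * j : ℕ) : ℝ) * (((m * j : ℕ) : ℝ) * (b / x ^ ε))
        ≤ κ * l * (κ * l * (b / x ^ ε)) := by gcongr
      _ = κ ^ 2 * b * (l ^ 2 / x ^ ε) := by ring
      _ ≤ _ := by
        gcongr
        have : 0 ≤ κ * b := by positivity
        linarith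
  · have hρj : ρ ^ j ≤ 1 / x ^ ε := pow_le_one_div_rpow hρ0 hρ1 hε hx0 (Nat.le_ceil _)
    calc ρ ^ j ≤ 1 * (l ^ 2 / x ^ ε) := by rw [one_mul]; exact hρj.trans hR
      _ ≤ _ := by
        gcongr
        have : 0 ≤ κ * b + κ ^ 2 * b := by positivity
        linarith
  · calc learningRate a t₀ ε t = a * (1 / x ^ ε) := by rw [learningRate, ← hx]; ring
      _ ≤ a * (l ^ 2 / x ^ ε) := by gcongr
      _ ≤ _ := by
        gcongr
        have : 0 ≤ κ * b + κ ^ 2 * b := by positivity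
        linarith

end Schedule

/-! ### The drift recursion in the Euclidean norm -/

section Drift

variable {d : ℕ} {Y : Type*} [Fintype Y] [DecidableEq Y]
  {P : EuclideanSpace ℝ (Fin d) → Matrix Y Y ℝ}
  {H : EuclideanSpace ℝ (Fin d) → Y → EuclideanSpace ℝ (Fin d)}

lemma measurable_matrix_pow_apply (hP : ∀ y y', Measurable fun w => P w y y') (n : ℕ) (y y' : Y) :
    Measurable fun w => (P w ^ n) y y' := by
  induction n generalizing y with
  | zero => simp
  | succ n ih =>
    simp_rw [pow_succ', Matrix.mul_apply]
    exact Finset.measurable_sum _ fun z _ => (hP y z).mul (ih z)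

/-- A pointwise choice has no evident measurability, but mixing exhibits it as a limit of entries of
powers of `P w`. -/
lemma UniformlyErgodic.measurable_stationaryDist [Nonempty Y] (hP : UniformlyErgodic P)
    (hPm : ∀ y y', Measurable fun w => P w y y') (z : Y) :
    Measurable fun w => stationaryDist (P w) z := by
  obtain ⟨-, m, -, ρ, hρ0, hρ1, hmix⟩ := hP.exists_mixing
  obtain ⟨y₀⟩ := ‹Nonempty Y›
  refine measurable_of_tendsto_metrizable
    (fun j : ℕ => measurable_matrix_pow_apply hPm (m * j) y₀ z) (tendsto_pi_nhds.2 fun w => ?_)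
  rw [tendsto_iff_norm_sub_tendsto_zero]
  refine squeeze_zero (fun _ => norm_nonneg _) (g := fun j => ρ ^ j * (2 * 1)) (fun j => ?_) ?_
  · have := hmix w j (Pi.single z 1) 1
      (fun y => by by_cases h : y = z <;> simp [h]) y₀
    simpa [Pi.single_apply] using this
  · have := (tendsto_pow_atTop_nhds_zero_of_lt_one hρ0.le hρ1).mul_const (2 * 1)
    rwa [zero_mul] at this

lemma norm_sum_smul_le {E : Type*} [NormedAddCommGroup E] [NormedSpace ℝ E] {Y : Type*}
    [Fintype Y] {p : Y → ℝ} (hp : ∀ y, 0 ≤ p y) (hp1 : ∑ y, p y = 1) {v : Y → E} {B : ℝ}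
    (hv : ∀ y, ‖v y‖ ≤ B) : ‖∑ y, p y • v y‖ ≤ B := by
  calc ‖∑ y, p y • v y‖ ≤ ∑ y, ‖p y • v y‖ := norm_sum_le _ _
    _ ≤ ∑ y, p y * B := Finset.sum_le_sum fun y _ => by
        rw [norm_smul, Real.norm_of_nonneg (hp y)]
        exact mul_le_mul_of_nonneg_left (hv y) (hp y)
    _ = B := by rw [← Finset.sum_mul, hp1, one_mul]

lemma exists_growth_bound {E F Y : Type*} [SeminormedAddCommGroup E] [SeminormedAddCommGroup F]
    [Finite Y] {f : E → Y → F} {C : ℝ} (hC : 0 ≤ C)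
    (hf : ∀ w₁ w₂ y, ‖f w₁ y - f w₂ y‖ ≤ C * ‖w₁ - w₂‖) :
    ∃ A, 0 ≤ A ∧ ∀ w y, ‖f w y‖ ≤ A * (1 + ‖w‖) := by
  have := Fintype.ofFinite Y
  refine ⟨C + ∑ y, ‖f 0 y‖, by positivity, fun w y => ?_⟩
  have h1 : ‖f w y‖ ≤ C * ‖w‖ + ‖f 0 y‖ := by
    have h2 := hf w 0 y
    rw [sub_zero] at h2
    exact (norm_le_norm_sub_add (f w y) (f 0 y)).trans (by linarith)
  have h3 : ‖f 0 y‖ ≤ ∑ y, ‖f 0 y‖ :=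
    Finset.single_le_sum (f := fun y => ‖f 0 y‖) (fun _ _ => norm_nonneg _) (Finset.mem_univ y)
  have h4 : 0 ≤ (∑ y, ‖f 0 y‖) * ‖w‖ := by positivity
  nlinarith

lemma IsLyapunov.continuous_gradient {L : EuclideanSpace ℝ (Fin d) → ℝ} {K : ℝ}
    (hL : IsLyapunov L K) : Continuous (gradient L) :=
  (LipschitzWith.of_dist_le_mul (K := ⟨K, hL.pos.le⟩) fun w w' => by
    rw [dist_eq_norm, dist_eq_norm]; exact hL.norm_gradient_sub_le w w').continuous

/-- The drift recursion, with all bounds expressed in the Euclidean norm, for processes whose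
iterates stay in a set `S` on which the transition matrices satisfy the damped Lipschitz bound and
the expected update is Lipschitz. -/
theorem exists_lyapunovRecursion [Nonempty Y] (hP : UniformlyErgodic P)
    (hPm : ∀ y y', Measurable fun w => P w y y') {C D : ℝ} (hC : 0 ≤ C) (hD : 0 ≤ D)
    (hH : ∀ w₁ w₂ y, ‖H w₁ y - H w₂ y‖ ≤ C * ‖w₁ - w₂‖)
    {S : Set (EuclideanSpace ℝ (Fin d))}
    (hdamp : ∀ w₁ ∈ S, ∀ w₂ ∈ S, ∀ y,
      ∑ y', |P w₁ y y' - P w₂ y y'| ≤ D / (1 + ‖w₁‖ + ‖w₂‖) * ‖w₁ - w₂‖)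
    (hh : ∀ w₁ ∈ S, ∀ w₂ ∈ S, ‖expectedUpdate P H w₁ - expectedUpdate P H w₂‖ ≤ C * ‖w₁ - w₂‖)
    {L : EuclideanSpace ℝ (Fin d) → ℝ} {K : ℝ} (hL : IsLyapunov L K)
    {a t₀ ε : ℝ} (ha : 0 < a) (ht₀ : 0 < t₀) (hε : 0 < ε) :
    ∃ (T : ℕ) (f : ℕ → ℝ),
      f =O[atTop] (fun t : ℕ =>
        Real.log ((t : ℝ) + t₀ + 1) ^ 2 / ((t : ℝ) + t₀) ^ (2 * ε)) ∧
      ∀ {Ω : Type*} {mΩ : MeasurableSpace Ω} (μ : Measure Ω) [IsProbabilityMeasure μ]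
        (ℱ : Filtration ℕ mΩ) (w : ℕ → Ω → EuclideanSpace ℝ (Fin d)) (η : ℕ → Ω → Y),
        IsSAProcess μ ℱ (learningRate a t₀ ε) P H w η →
        Integrable (fun ω => (1 + ‖w 0 ω‖) ^ 2) μ → (∀ᵐ ω ∂μ, ∀ t, w t ω ∈ S) →
        LyapunovRecursion μ L (expectedUpdate P H) (learningRate a t₀ ε) w T f := by
  obtain ⟨hst, m, hm, ρ, hρ0, hρ1, hmix⟩ := hP.exists_mixing
  set h := expectedUpdate P H with hh_def
  have hHm : ∀ y, Measurable fun w => H w y := fun y =>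
    (LipschitzWith.of_dist_le_mul (K := ⟨C, hC⟩) fun w w' => by
      rw [dist_eq_norm, dist_eq_norm]; exact hH w w' y).continuous.measurable
  have hhm : Measurable h := by
    rw [hh_def]
    unfold expectedUpdate
    exact Finset.measurable_sum _ fun y _ => (hP.measurable_stationaryDist hPm y).smul (hHm y)
  obtain ⟨A, hA, hHA⟩ := exists_growth_bound hC hH
  have hhA : ∀ w, ‖h w‖ ≤ A * (1 + ‖w‖) := fun w =>
    norm_sum_smul_le (hst w).1 (hst w).2.1 (hHA w)
  obtain ⟨K₂, hK₂, hgA⟩ := exists_growth_bound (Y := Unit) (f := fun w _ => gradient L w)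
    hL.pos.le fun w₁ w₂ _ => hL.norm_gradient_sub_le w₁ w₂
  have hgA : ∀ w, ‖gradient L w‖ ≤ K₂ * (1 + ‖w‖) := fun w => hgA w ()
  have hgm : Measurable (gradient L) := hL.continuous_gradient.measurable
  have hLm : Measurable L := hL.differentiable.continuous.measurable
  have hKp := hL.pos
  set g : EuclideanSpace ℝ (Fin d) → Y → ℝ := fun w y => ⟪gradient L w, H w y - h w⟫ with hg
  have hHh : ∀ w y, ‖H w y - h w‖ ≤ 2 * A * (1 + ‖w‖) := fun w y =>
    (norm_sub_le _ _).trans (by linarith [hHA w y, hhA w])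
  -- The first two summands come from the product rule for the Lipschitz bound on `g`, the last from
  -- its growth bound.
  set G := 2 * K * A + K₂ * (2 * C) + 2 * K₂ * A with hG
  have hG0 : 0 ≤ G := by positivity
  have hfield : IsTestField P g S D G := by
    refine ⟨hD, hG0, hPm, hP.1, hdamp, fun y => hgm.inner ((hHm y).sub hhm), fun w y => ?_,
      fun w₁ h₁ w₂ h₂ y => ?_⟩
    · calc |⟪gradient L w, H w y - h w⟫| ≤ ‖gradient L w‖ * ‖H w y - h w‖ :=
            abs_real_inner_le_norm _ _
        _ ≤ K₂ * (1 + ‖w‖) * (2 * A * (1 + ‖w‖)) := by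
            gcongr
            exacts [hgA w, hHh w y]
        _ = 2 * K₂ * A * (1 + ‖w‖) ^ 2 := by ring
        _ ≤ _ := by
            gcongr
            have : 0 ≤ 2 * K * A + K₂ * (2 * C) := by positivity
            linarith
    · have e : g w₁ y - g w₂ y = ⟪gradient L w₁ - gradient L w₂, H w₁ y - h w₁⟫
          + ⟪gradient L w₂, (H w₁ y - H w₂ y) - (h w₁ - h w₂)⟫ := by
        simp only [hg, inner_sub_left, inner_sub_right]; ring
      rw [e]
      have e1 : |⟪gradient L w₁ - gradient L w₂, H w₁ y - h w₁⟫|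
          ≤ K * ‖w₁ - w₂‖ * (2 * A * (1 + ‖w₁‖)) :=
        (abs_real_inner_le_norm _ _).trans (mul_le_mul (hL.norm_gradient_sub_le _ _) (hHh _ _)
          (norm_nonneg _) (by positivity))
      have e2 : |⟪gradient L w₂, (H w₁ y - H w₂ y) - (h w₁ - h w₂)⟫|
          ≤ K₂ * (1 + ‖w₂‖) * (2 * C * ‖w₁ - w₂‖) :=
        (abs_real_inner_le_norm _ _).trans (mul_le_mul (hgA _)
          ((norm_sub_le _ _).trans (by linarith [hH w₁ w₂ y, hh w₁ h₁ w₂ h₂]))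
          (norm_nonneg _) (by positivity))
      refine (abs_add_le _ _).trans ((add_le_add e1 e2).trans ?_)
      have n1 : 1 + ‖w₁‖ ≤ 1 + ‖w₁‖ + ‖w₂‖ := by linarith [norm_nonneg w₂]
      have n2 : 1 + ‖w₂‖ ≤ 1 + ‖w₁‖ + ‖w₂‖ := by linarith [norm_nonneg w₁]
      calc K * ‖w₁ - w₂‖ * (2 * A * (1 + ‖w₁‖)) + K₂ * (1 + ‖w₂‖) * (2 * C * ‖w₁ - w₂‖)
          ≤ K * ‖w₁ - w₂‖ * (2 * A * (1 + ‖w₁‖ + ‖w₂‖))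
            + K₂ * (1 + ‖w₁‖ + ‖w₂‖) * (2 * C * ‖w₁ - w₂‖) := by gcongr
        _ = (2 * K * A + K₂ * (2 * C)) * (1 + ‖w₁‖ + ‖w₂‖) * ‖w₁ - w₂‖ := by ring
        _ ≤ _ := by
            gcongr
            have : 0 ≤ 2 * K₂ * A := by positivity
            linarith
  have hcentred : ∀ w, ∑ z, stationaryDist (P w) z * g w z = 0 := by
    intro w
    have : ∑ z, stationaryDist (P w) z * g w z
        = ⟪gradient L w, ∑ z, stationaryDist (P w) z • (H w z - h w)⟫ := by
      rw [inner_sum]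
      exact Finset.sum_congr rfl fun z _ => (real_inner_smul_right _ _ _).symm
    rw [this]
    simp_rw [smul_sub]
    rw [Finset.sum_sub_distrib, ← Finset.sum_smul, (hst w).2.1, one_smul]
    simp [hh_def, expectedUpdate]
  have hmixg : ∀ j w y, |((P w ^ (m * j)) *ᵥ g w) y| ≤ ρ ^ j * (2 * G) * (1 + ‖w‖) ^ 2 := by
    intro j w y
    have := hmix w j (g w) _ (hfield.abs_le w) y
    rw [hcentred, sub_zero] at this
    exact this.trans (le_of_eq (by ring))
  -- The factor `4 * A` is the smallness required by the bias bound.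
  obtain ⟨T, B, hB, hwin⟩ := exists_window ha ht₀ hε hm hρ0 hρ1 (C := 4 * A) (by positivity)
  -- In order: moving the iterate, freezing the matrices, mixing (`4` times `2 * G`), and the
  -- second-order term of the expansion.
  set Q := (12 * G * A + 8 * D * A * G + 8 * G + K * A ^ 2) * B with hQ
  -- Both witnesses are fixed before any process is introduced, hence do not depend on it.
  refine ⟨T, fun t => Q * K * a *
    (Real.log ((t : ℝ) + t₀ + 1) ^ 2 / ((t : ℝ) + t₀) ^ (2 * ε)), isBigO_const_mul_self _ _ _, ?_⟩
  intro Ω mΩ μ _ ℱ w η hproc hint hS t ht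
  have hI := hproc.integrable_growth hHm hA hHA hint
  have hwm := hproc.measurable_iterate_ambient hHm
  have hα0 : ∀ t, 0 ≤ learningRate a t₀ ε t := fun t => by unfold learningRate; positivity
  have hLint : ∀ t, Integrable (fun ω => L (w t ω)) μ := fun t =>
    ((hI t).const_mul K).mono' (hLm.comp (hwm t)).aestronglyMeasurable (.of_forall fun ω => by
      rw [Real.norm_of_nonneg (hL.nonneg _)]; exact hL.le_growth _)
  have hDint : Integrable (fun ω => ⟪gradient L (w t ω), h (w t ω)⟫) μ := by
    refine ((hI t).const_mul (K₂ * A)).mono'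
      ((hgm.comp (hwm t)).inner (hhm.comp (hwm t))).aestronglyMeasurable (.of_forall fun ω => ?_)
    refine (norm_inner_le_norm _ _).trans ?_
    calc ‖gradient L (w t ω)‖ * ‖h (w t ω)‖
        ≤ K₂ * (1 + ‖w t ω‖) * (A * (1 + ‖w t ω‖)) := by
          gcongr
          exacts [hgA _, hhA _]
      _ = _ := by ring
  have hGint : Integrable (fun ω => g (w t ω) (η (t + 1) ω)) μ := by
    simpa using hproc.integrable_pow hHm hfield (hI t) 0 (t + 1)
  refine ⟨hLint t, hLint (t + 1), hDint, ?_⟩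
  obtain ⟨s, p, j, β, rfl, hpj, hαβ, hβ, hb1, hb2, hb3, hb4⟩ := hwin t ht
  set R := Real.log (((s + p : ℕ) : ℝ) + t₀ + 1) ^ 2 / (((s + p : ℕ) : ℝ) + t₀) ^ ε with hR
  set αt := learningRate a t₀ ε (s + p) with hαt
  have hαt0 : 0 ≤ αt := hα0 _
  have hbias := hproc.abs_integral_field_le hHm hA hHA hfield hS hint hα0 hαβ hβ
    (r := ρ ^ j * (2 * G)) (by positivity) (by rw [hpj]; exact hmixg j)
  set M := ∫ ω, (1 + ‖w (s + p) ω‖) ^ 2 ∂μ with hM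
  have hM0 : 0 ≤ M := integral_nonneg fun ω => by positivity
  -- This inequality makes the same `f` appear as a factor of `E L(w_t)` and as an additive term.
  have hMK : M ≤ K * (1 + ∫ ω, L (w (s + p) ω) ∂μ) := by
    have : K * (1 + ∫ ω, L (w (s + p) ω) ∂μ) = ∫ ω, K * (1 + L (w (s + p) ω)) ∂μ := by
      rw [integral_const_mul, integral_add (integrable_const _) (hLint _)]
      simp
    rw [this]
    exact integral_mono (hI _) (((integrable_const _).add (hLint _)).const_mul K)
      fun ω => hL.growth_le _
  have hstep : ∫ ω, L (w (s + p + 1) ω) ∂μ ≤ ∫ ω, L (w (s + p) ω) ∂μ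
      + αt * ∫ ω, ⟪gradient L (w (s + p) ω), h (w (s + p) ω)⟫ ∂μ
      + αt * ∫ ω, g (w (s + p) ω) (η (s + p + 1) ω) ∂μ + K * (αt * A) ^ 2 * M := by
    have I1 : Integrable (fun ω => L (w (s + p) ω)
        + αt * ⟪gradient L (w (s + p) ω), h (w (s + p) ω)⟫) μ := (hLint _).add (hDint.const_mul _)
    have I2 : Integrable (fun ω => L (w (s + p) ω)
        + αt * ⟪gradient L (w (s + p) ω), h (w (s + p) ω)⟫
        + αt * g (w (s + p) ω) (η (s + p + 1) ω)) μ := I1.add (hGint.const_mul _)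
    rw [← integral_const_mul, ← integral_const_mul, hM, ← integral_const_mul,
      ← integral_add (hLint _) (hDint.const_mul _), ← integral_add I1 (hGint.const_mul _),
      ← integral_add I2 ((hI _).const_mul _)]
    refine integral_mono (hLint _) (I2.add ((hI _).const_mul _)) fun ω => ?_
    have h1 := hL.le_add (w (s + p) ω) (w (s + p + 1) ω)
    have h2 : w (s + p + 1) ω - w (s + p) ω = αt • H (w (s + p) ω) (η (s + p + 1) ω) := by
      rw [hproc.update]; abel
    have h3 : ⟪gradient L (w (s + p) ω), w (s + p + 1) ω - w (s + p) ω⟫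
        = αt * ⟪gradient L (w (s + p) ω), h (w (s + p) ω)⟫
          + αt * g (w (s + p) ω) (η (s + p + 1) ω) := by
      rw [h2, real_inner_smul_right]
      simp only [hg, inner_sub_right]
      ring
    have h4 : ‖w (s + p + 1) ω - w (s + p) ω‖ ≤ αt * A * (1 + ‖w (s + p) ω‖) := by
      rw [h2, norm_smul, Real.norm_of_nonneg hαt0, mul_assoc]
      exact mul_le_mul_of_nonneg_left (hHA _ _) hαt0
    have h5 : K * ‖w (s + p + 1) ω - w (s + p) ω‖ ^ 2
        ≤ K * (αt * A) ^ 2 * (1 + ‖w (s + p) ω‖) ^ 2 := by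
      rw [mul_assoc, ← mul_pow]
      gcongr
    linarith
  have hcoef : 12 * G * A * (((p + 1 : ℕ) : ℝ) * β)
      + 8 * D * A * G * (((p + 1 : ℕ) : ℝ) * (((p + 1 : ℕ) : ℝ) * β)) + 4 * (ρ ^ j * (2 * G))
      ≤ (12 * G * A + 8 * D * A * G + 8 * G) * (B * R) := by
    have e1 : 12 * G * A * (((p + 1 : ℕ) : ℝ) * β) ≤ 12 * G * A * (B * R) := by gcongr
    have e2 : 8 * D * A * G * (((p + 1 : ℕ) : ℝ) * (((p + 1 : ℕ) : ℝ) * β))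
        ≤ 8 * D * A * G * (B * R) := by gcongr
    have e3 : 8 * G * ρ ^ j ≤ 8 * G * (B * R) := by gcongr
    linarith
  have hdrift : αt * ∫ ω, g (w (s + p) ω) (η (s + p + 1) ω) ∂μ + K * (αt * A) ^ 2 * M
      ≤ Q * (αt * R) * M := by
    have e1 : αt * ∫ ω, g (w (s + p) ω) (η (s + p + 1) ω) ∂μ
        ≤ αt * ((12 * G * A + 8 * D * A * G + 8 * G) * (B * R) * M) :=
      mul_le_mul_of_nonneg_left ((le_abs_self _).trans (hbias.trans (by gcongr))) hαt0
    have e2 : K * (αt * A) ^ 2 * M ≤ K * A ^ 2 * (αt * (B * R)) * M := by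
      calc K * (αt * A) ^ 2 * M = K * A ^ 2 * (αt * αt) * M := by ring
        _ ≤ _ := by gcongr
    calc _ ≤ _ := add_le_add e1 e2
      _ = _ := by rw [hQ]; ring
  have hrate : αt * R = a * (Real.log (((s + p : ℕ) : ℝ) + t₀ + 1) ^ 2
      / (((s + p : ℕ) : ℝ) + t₀) ^ (2 * ε)) := by
    have hx : 0 < ((s + p : ℕ) : ℝ) + t₀ := by positivity
    rw [hαt, hR, learningRate, two_mul, Real.rpow_add hx]
    field_simp
  have hfin : Q * (αt * R) * M ≤ Q * (αt * R) * (K * (1 + ∫ ω, L (w (s + p) ω) ∂μ)) := by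
    have hR0 : 0 ≤ R := by positivity
    have hQ0 : 0 ≤ Q := by positivity
    gcongr
  rw [hrate] at hfin hdrift
  simp only
  linarith

end Drift

/-! ### Transfer from the given norm to the Euclidean norm -/

section Main

variable {d : ℕ} {Y : Type*} [Fintype Y] {N : Seminorm ℝ (EuclideanSpace ℝ (Fin d))}

lemma norm_sub_le_of_seminorm_sub_le {A B C : ℝ} (hA : ∀ x, N x ≤ A * ‖x‖)
    (hB0 : 0 < B) (hB : ∀ x, ‖x‖ ≤ B * N x) {x x' v v' : EuclideanSpace ℝ (Fin d)}
    (h : N (v - v') ≤ C * N (x - x')) : ‖v - v'‖ ≤ B * (|C| * A) * ‖x - x'‖ := by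
  calc ‖v - v'‖ ≤ B * N (v - v') := hB _
    _ ≤ B * (|C| * (A * ‖x - x'‖)) := by
        gcongr
        refine h.trans ?_
        gcongr
        exacts [le_abs_self C, hA _]
    _ = _ := by ring

lemma measurable_apply_of_rowLipschitz {P : EuclideanSpace ℝ (Fin d) → Matrix Y Y ℝ} {D : ℝ}
    (hD : 0 ≤ D) (hP : ∀ w₁ w₂ y, ∑ y', |P w₁ y y' - P w₂ y y'| ≤ D * ‖w₁ - w₂‖) (y y' : Y) :
    Measurable fun w => P w y y' :=
  (LipschitzWith.of_dist_le_mul (K := ⟨D, hD⟩) fun w w' => by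
    rw [dist_eq_norm, dist_eq_norm]
    exact (Finset.single_le_sum (f := fun y' => |P w y y' - P w' y y'|)
      (fun _ _ => abs_nonneg _) (Finset.mem_univ y')).trans (hP w w' y)).continuous.measurable

lemma rowDamped_of_seminorm {A B C : ℝ} (hA0 : 0 < A) (hA : ∀ x, N x ≤ A * ‖x‖)
    (hB0 : 0 < B) (hB : ∀ x, ‖x‖ ≤ B * N x) {w₁ w₂ : EuclideanSpace ℝ (Fin d)} {r : ℝ}
    (h : r ≤ C / (1 + N w₁ + N w₂) * N (w₁ - w₂)) :
    r ≤ |C| * A * (1 + B) / (1 + ‖w₁‖ + ‖w₂‖) * ‖w₁ - w₂‖ := by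
  have h1 := apply_nonneg N w₁
  have h2 := apply_nonneg N w₂
  have hden : 1 + ‖w₁‖ + ‖w₂‖ ≤ (1 + B) * (1 + N w₁ + N w₂) := by
    linarith [hB w₁, hB w₂]
  have hinv : 1 / (1 + N w₁ + N w₂) ≤ (1 + B) / (1 + ‖w₁‖ + ‖w₂‖) := by
    rw [div_le_div_iff₀ (by positivity) (by positivity)]
    linarith
  calc r ≤ C / (1 + N w₁ + N w₂) * N (w₁ - w₂) := h
    _ ≤ |C| / (1 + N w₁ + N w₂) * (A * ‖w₁ - w₂‖) := by
        gcongr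
        exacts [le_abs_self C, hA _]
    _ = |C| * A * (1 / (1 + N w₁ + N w₂)) * ‖w₁ - w₂‖ := by ring
    _ ≤ |C| * A * ((1 + B) / (1 + ‖w₁‖ + ‖w₂‖)) * ‖w₁ - w₂‖ := by gcongr
    _ = _ := by ring

lemma div_growth_mul_norm_le {D : ℝ} (hD : 0 ≤ D) (w₁ w₂ : EuclideanSpace ℝ (Fin d)) :
    D / (1 + ‖w₁‖ + ‖w₂‖) * ‖w₁ - w₂‖ ≤ D * ‖w₁ - w₂‖ := by
  gcongr
  exact div_le_self hD (by linarith [norm_nonneg w₁, norm_nonneg w₂])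

lemma not_isEmpty_noise {Y Ω : Type*} {mΩ : MeasurableSpace Ω} (μ : Measure Ω)
    [IsProbabilityMeasure μ] (η : ℕ → Ω → Y) : ¬ IsEmpty Y := fun _ =>
  (nonempty_of_isProbabilityMeasure μ).elim fun ω => isEmptyElim (η 0 ω)

end Main

end MarkovSA

theorem theorem3 {d : ℕ} {Y : Type*} [Fintype Y] [DecidableEq Y]
    (N : Seminorm ℝ (EuclideanSpace ℝ (Fin d))) (hN : MarkovSA.IsNorm N)
    (hsmooth : ∃ K : ℝ, MarkovSA.IsSmoothWith N K (fun w => N w ^ 2))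
    (P : EuclideanSpace ℝ (Fin d) → Matrix Y Y ℝ)
    (H : EuclideanSpace ℝ (Fin d) → Y → EuclideanSpace ℝ (Fin d))
    (hP : MarkovSA.UniformlyErgodic P) (hH : MarkovSA.UpdateLipschitz N H)
    (a t₀ ε : ℝ) (ha : 0 < a) (ht₀ : 0 < t₀) (hε : 1 / 2 < ε) (hε1 : ε ≤ 1)
    (wref : EuclideanSpace ℝ (Fin d)) :
    (MarkovSA.DampedLipschitz N P H →
      ∃ (T : ℕ) (f : ℕ → ℝ),
        f =O[atTop] (fun t : ℕ =>
          Real.log ((t : ℝ) + t₀ + 1) ^ 2 / ((t : ℝ) + t₀) ^ (2 * ε)) ∧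
        ∀ {Ω : Type*} {mΩ : MeasurableSpace Ω} (μ : Measure Ω) [IsProbabilityMeasure μ]
          (ℱ : Filtration ℕ mΩ) (w : ℕ → Ω → EuclideanSpace ℝ (Fin d)) (η : ℕ → Ω → Y),
          MarkovSA.IsSAProcess μ ℱ (MarkovSA.learningRate a t₀ ε) P H w η →
          Integrable (fun ω => N (w 0 ω) ^ 2) μ →
          MarkovSA.LyapunovRecursion μ (MarkovSA.lyapunov N wref) (MarkovSA.expectedUpdate P H)
            (MarkovSA.learningRate a t₀ ε) w T f) ∧
    (∀ U : ℝ, MarkovSA.LocallyLipschitzUpTo N U P H →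
      ∃ (T : ℕ) (f : ℕ → ℝ),
        f =O[atTop] (fun t : ℕ =>
          Real.log ((t : ℝ) + t₀ + 1) ^ 2 / ((t : ℝ) + t₀) ^ (2 * ε)) ∧
        ∀ {Ω : Type*} {mΩ : MeasurableSpace Ω} (μ : Measure Ω) [IsProbabilityMeasure μ]
          (ℱ : Filtration ℕ mΩ) (w : ℕ → Ω → EuclideanSpace ℝ (Fin d)) (η : ℕ → Ω → Y),
          MarkovSA.IsSAProcess μ ℱ (MarkovSA.learningRate a t₀ ε) P H w η →
          (∀ᵐ ω ∂μ, BddAbove (Set.range fun t => N (w t ω)) ∧ (⨆ t, N (w t ω)) < U) →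
          MarkovSA.LyapunovRecursion μ (MarkovSA.lyapunov N wref) (MarkovSA.expectedUpdate P H)
            (MarkovSA.learningRate a t₀ ε) w T f) := by
  obtain ⟨K, hL⟩ := MarkovSA.exists_isLyapunov N hN hsmooth wref
  obtain ⟨A, hA0, hA⟩ := MarkovSA.exists_seminorm_le N
  obtain ⟨B, hB0, hB⟩ := MarkovSA.exists_norm_le_seminorm N hN
  obtain ⟨CH, hCH⟩ := hH
  have hε0 : 0 < ε := by linarith
  -- Without states there is no process, since a probability space is nonempty.
  rcases isEmpty_or_nonempty Y with hY | hY
  · refine ⟨fun _ => ⟨0, 0, isBigO_zero _ _, ?_⟩, fun _ _ => ⟨0, 0, isBigO_zero _ _, ?_⟩⟩ <;>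
    · intro Ω mΩ μ _ ℱ w η
      exact absurd hY (MarkovSA.not_isEmpty_noise μ η)
  constructor
  · rintro ⟨C, hPC, hhC⟩
    have hdamp := fun w₁ w₂ y => MarkovSA.rowDamped_of_seminorm hA0 hA hB0 hB (hPC w₁ w₂ y)
    have hD : 0 ≤ |C| * A * (1 + B) := by positivity
    have hPm := MarkovSA.measurable_apply_of_rowLipschitz hD fun w₁ w₂ y =>
      (hdamp w₁ w₂ y).trans (MarkovSA.div_growth_mul_norm_le hD w₁ w₂)
    obtain ⟨T, f, hf, hrec⟩ := MarkovSA.exists_lyapunovRecursion hP hPm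
      (C := B * (|CH| * A) + B * (|C| * A)) (by positivity) hD (S := Set.univ)
      (fun w₁ w₂ y => (MarkovSA.norm_sub_le_of_seminorm_sub_le hA hB0 hB (hCH w₁ w₂ y)).trans
        (by gcongr; exact le_add_of_nonneg_right (by positivity)))
      (fun w₁ _ w₂ _ y => hdamp w₁ w₂ y)
      (fun w₁ _ w₂ _ => (MarkovSA.norm_sub_le_of_seminorm_sub_le hA hB0 hB (hhC w₁ w₂)).trans
        (by gcongr; exact le_add_of_nonneg_left (by positivity))) hL ha ht₀ hε0
    refine ⟨T, f, hf, fun {Ω mΩ} μ _ ℱ w η hproc hint => hrec μ ℱ w η hproc ?_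
      (.of_forall fun _ _ => Set.mem_univ _)⟩
    have hw0 : Measurable (w 0) := hproc.measurable_init.mono (ℱ.le 0) le_rfl
    refine ((integrable_const (2 : ℝ)).add (hint.const_mul (2 * B ^ 2))).mono'
      ((hw0.norm.const_add 1).pow_const 2).aestronglyMeasurable (.of_forall fun ω => ?_)
    rw [Real.norm_of_nonneg (by positivity)]
    have h1 : 1 + ‖w 0 ω‖ ≤ 1 + B * N (w 0 ω) := by linarith [hB (w 0 ω)]
    calc (1 + ‖w 0 ω‖) ^ 2 ≤ (1 + B * N (w 0 ω)) ^ 2 := by gcongr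
      _ ≤ 2 + 2 * B ^ 2 * N (w 0 ω) ^ 2 := by nlinarith [sq_nonneg (1 - B * N (w 0 ω))]
  · rintro U ⟨C, hPC, hhC⟩
    have hlip : ∀ w₁ w₂ y, ∑ y', |P w₁ y y' - P w₂ y y'| ≤ |C| * A * ‖w₁ - w₂‖ := by
      intro w₁ w₂ y
      calc _ ≤ C * N (w₁ - w₂) := hPC w₁ w₂ y
        _ ≤ |C| * (A * ‖w₁ - w₂‖) := by
            gcongr
            exacts [le_abs_self C, hA _]
        _ = _ := by ring
    have hPm := MarkovSA.measurable_apply_of_rowLipschitz (by positivity) hlip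
    have hbd : ∀ v, N v ≤ U → ‖v‖ ≤ B * |U| := fun v hv =>
      (hB v).trans (by gcongr; exact hv.trans (le_abs_self U))
    -- On the ball the denominator `1 + ‖w₁‖ + ‖w₂‖` is at most `1 + 2 * (B * |U|)`, so the plain
    -- Lipschitz bound is a damped one with `D` enlarged by this factor.
    obtain ⟨T, f, hf, hrec⟩ := MarkovSA.exists_lyapunovRecursion hP hPm
      (C := B * (|CH| * A) + B * (|C| * A)) (D := |C| * A * (1 + 2 * (B * |U|))) (by positivity)
      (by positivity) (S := {v | N v ≤ U})
      (fun w₁ w₂ y => (MarkovSA.norm_sub_le_of_seminorm_sub_le hA hB0 hB (hCH w₁ w₂ y)).trans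
        (by gcongr; exact le_add_of_nonneg_right (by positivity)))
      (fun w₁ h₁ w₂ h₂ y => (hlip w₁ w₂ y).trans (by
        gcongr
        rw [le_div_iff₀ (by positivity)]
        refine mul_le_mul_of_nonneg_left ?_ (by positivity)
        linarith [hbd w₁ h₁, hbd w₂ h₂]))
      (fun w₁ h₁ w₂ h₂ =>
        (MarkovSA.norm_sub_le_of_seminorm_sub_le hA hB0 hB (hhC w₁ w₂ (max_le h₁ h₂))).trans
        (by gcongr; exact le_add_of_nonneg_left (by positivity))) hL ha ht₀ hε0
    refine ⟨T, f, hf, fun {Ω mΩ} μ _ ℱ w η hproc hbdd => ?_⟩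
    have hS : ∀ᵐ ω ∂μ, ∀ t, w t ω ∈ {v | N v ≤ U} := by
      filter_upwards [hbdd] with ω hω t
      -- Boundedness is essential: the real supremum of an unbounded family is `0` by convention.
      exact (le_ciSup hω.1 t).trans hω.2.le
    refine hrec μ ℱ w η hproc ?_ hS
    have hw0 : Measurable (w 0) := hproc.measurable_init.mono (ℱ.le 0) le_rfl
    refine (integrable_const ((1 + B * |U|) ^ 2)).mono'
      ((hw0.norm.const_add 1).pow_const 2).aestronglyMeasurable ?_
    filter_upwards [hS] with ω hω
    rw [Real.norm_of_nonneg (by positivity)]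
    gcongr
    exact hbd _ (hω 0)
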